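/- **Language.** Fix sets $\mathcal A$ (agent identifiers), $\mathcal C$ (handshake names), $\mathcal B$ (broadcast names) and $\mathcal S$ (signals). Actions are $Act=\mathcal C\uplus\bar{\mathcal C}\uplus\{\tau\}\uplus\{b!,b?\mid b\in\mathcal B\}\uplus\mathcal S$, and labels are $\mathcal L=Act\uplus\{b{:}\mid b\in\mathcal B\}\uplus\bar{\mathcal S}$; $\bar{\bar c}=c$. A relabelling is a function $f$ consisting of maps $\mathcal C\to\mathcal C$, $\mathcal B\to\mathcal B$, $\mathcal S\to\mathcal S$, extended to $\mathcal L$ by $f(\bar c)=\overline{f(c)}$, $f(\tau)=\tau$, $f(b\sharp)=f(b)\sharp$. ABCdE processes are $$P::=\mathbf 0\mid\alpha.P\mid P+P\mid P|P\mid P\backslash L\mid P[f]\mid A\mid P\hat{\ }s\qquad(\alpha\in Act,\ L\subseteq\mathcal C\uplus\mathcal S,\ A\in\mathcal A,\ s\in\mathcal S),$$ where each $A$ has a defining equation $A\stackrel{def}{=}P$ in which every agent identifier of $P$ lies within the scope of an action prefix. Let $\alpha$ range over $Act$, $\ell$ over $\mathcal L$, $c$ over $\mathcal C\uplus\bar{\mathcal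 C}\uplus\mathcal S\uplus\bar{\mathcal S}$, and $\eta$ over $\mathcal C\uplus\bar{\mathcal C}\uplus\{\tau\}\uplus\mathcal S\uplus\bar{\mathcal S}$. The rules are, with names of the derivations in parentheses ($t,u$ naming the derivations of the premises, in order): * $\alpha.P\xrightarrow{\alpha}P$ (named $\underline{\alpha}P$). From $P\xrightarrow{\alpha}P'$: $P+Q\xrightarrow{\alpha}P'$ ($t+Q$), $P\hat{\ }r\xrightarrow{\alpha}P'$ ($t\hat{\ }r$), and $A\xrightarrow{\alpha}P'$ if $A\stackrel{def}{=}P$ ($A{:}t$). From $Q\xrightarrow{\alpha}Q'$: $P+Q\xrightarrow{\alpha}Q'$ ($P+u$). * From $P\xrightarrow{\eta}P'$: $P|Q\xrightarrow{\eta}P'|Q$ ($t|Q$). From $Q\xrightarrow{\eta}Q'$: $P|Q\xrightarrow{\eta}P|Q'$ ($P|u$). From $P\xrightarrow{c}P'$ and $Q\xrightarrow{\bar c}Q'$: $P|Q\xrightarrow{\tau}P'|Q'$ ($t|u$). * From $P\xrightarrow{\ell}P'$: $P\backslash L\xrightarrow{\ell}P'\backslash L$ if $\ell\notin L\cup\bar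 L$ ($t\backslash L$), and $P[f]\xrightarrow{f(\ell)}P'[f]$ ($t[f]$). * $\mathbf 0\xrightarrow{b:}\mathbf 0$ ($b{:}\mathbf 0$). $\alpha.P\xrightarrow{b:}\alpha.P$ if $\alpha\ne b?$ ($b{:}\alpha.P$). From $P\xrightarrow{b:}P'$ and $Q\xrightarrow{b:}Q'$: $P+Q\xrightarrow{b:}P'+Q'$ ($t+u$). From $P\xrightarrow{b:}P'$: $A\xrightarrow{b:}A$ if $A\stackrel{def}{=}P$ ($A{:}t$), and $P\hat{\ }r\xrightarrow{b:}P'\hat{\ }r$ ($t\hat{\ }r$). From $P\xrightarrow{b\sharp_1}P'$ and $Q\xrightarrow{b\sharp_2}Q'$: $P|Q\xrightarrow{b\sharp}P'|Q'$ ($t|u$), where $\sharp=\sharp_1\circ\sharp_2$ is $!$ if exactly one of $\sharp_1,\sharp_2$ is $!$, undefined if both are, and otherwise $?$ if at least one is $?$, and ${:}$ if both are ${:}$. * $P\hat{\ }s\xrightarrow{\bar s}P\hat{\ }s$ (named $P^{\to s}$). From $P\xrightarrow{\bar s}P'$: $P+Q\xrightarrow{\bar s}P'+Q$ ($t+Q$),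 $P\hat{\ }r\xrightarrow{\bar s}P'\hat{\ }r$ ($t\hat{\ }r$), and $A\xrightarrow{\bar s}A$ if $A\stackrel{def}{=}P$ ($A{:}t$). From $Q\xrightarrow{\bar s}Q'$: $P+Q\xrightarrow{\bar s}P+Q'$ ($P+u$). A *transition* is a derivation $t$ of a triple $P\xrightarrow{\ell}Q$; put $src(t)=P$, $\ell(t)=\ell$, $tgt(t)=Q$. **The relation $\leadsto$** is the smallest ternary relation on transitions such that 1. $\ell(\zeta)\notin Act$ and $src(\zeta)=src(\chi)$ imply $\chi\leadsto_\zeta\chi$; 2. $\ell(t)\in\{b?,b{:}\}$ and $src(t)=P$ imply $\underline{b?}P\leadsto_{\underline{b?}P}t$ and $b{:}\alpha.P\leadsto_{\underline{\alpha}P}t$; 3. $\ell(v)\notin\bar{\mathcal S}$ and $t\leadsto_vt'$ imply $t+Q\leadsto_{v+Q}t'$ and $t+u\leadsto_{v+Q}t'$; 4. $\ell(w)\notin\bar{\mathcal S}$ and $u\leadsto_wu'$ imply $P+u\leadsto_{P+w}u'$ and $t+u\leadsto_{P+w}u'$; 5. $\ell(w)\notin\bar{\mathcal S}$, $\ell(t)=b?$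 and $\ell(u')\in\{b?,b{:}\}$ imply $t+Q\leadsto_{P+w}u'$; 6. $\ell(v)\notin\bar{\mathcal S}$, $\ell(u)=b?$ and $\ell(t')\in\{b?,b{:}\}$ imply $P+u\leadsto_{v+Q}t'$; 7. $t|Q\leadsto_{P|w}t|tgt(w)$ and $P|u\leadsto_{v|Q}tgt(v)|u$; 8. $t\leadsto_vt'$ implies $t|Q\leadsto_{v|Q}t'|Q$, $t|Q\leadsto_{v|w}t'|tgt(w)$ and $t|u\leadsto_{v|Q}t'|u$; 9. $u\leadsto_wu'$ implies $P|u\leadsto_{P|w}P|u'$, $P|u\leadsto_{v|w}tgt(v)|u'$ and $t|u\leadsto_{P|w}t|u'$; 10. $t\leadsto_vt'$ and $u\leadsto_wu'$ imply $t|u\leadsto_{v|w}t'|u'$; 11. $\ell(v)\in Act$ and $t\leadsto_vt'$ imply $t\backslash L\leadsto_{v\backslash L}t'\backslash L$, $t[f]\leadsto_{v[f]}t'[f]$, $A{:}t\leadsto_{A:v}t'$ and $t\hat{\ }r\leadsto_{v\hat{\ }r}t'$; in items 3–11 with $src(t)=src(v)=P$, $src(u)=src(w)=Q$, $src(t')=tgt(v)$,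 $src(u')=tgt(w)$, and throughout provided the composed transitions exist. **Synchrons.** A synchron is $\sigma\lambda$ with $\sigma$ a finite sequence of arguments $+_{\mathrm L},+_{\mathrm R},|_{\mathrm L},|_{\mathrm R},\backslash L,[f],A{:},\hat{\ }r$ and $\lambda$ a leaf $(\underline{\alpha}P)$, $(b{:})$ or $(P^{\to s})$. The set $\varsigma(t)$ of synchrons of $t$ is obtained by recursion on the name of $t$: it is $\{(\underline{\alpha}P)\}$, $\{(b{:})\}$, $\{(b{:})\}$, $\{(P^{\to s})\}$ for $\underline{\alpha}P$, $b{:}\mathbf 0$, $b{:}\alpha.P$, $P^{\to s}$; prefixing every synchron by the corresponding argument, $\varsigma(t+Q)={+_{\mathrm L}}\varsigma(t)$, $\varsigma(P+u)={+_{\mathrm R}}\varsigma(u)$, $\varsigma(t+u)={+_{\mathrm L}}\varsigma(t)\cup{+_{\mathrm R}}\varsigma(u)$, likewise for $|$, and $\varsigma(t\backslash L)={\backslash L}\,\varsigma(t)$, $\varsigma(t[f])=[f]\varsigma(t)$, $\varsigma(A{:}t)=A{:}\varsigma(t)$, $\varsigma(t\hat{\ }r)=\hat{\ }r\,\varsigma(t)$.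 A synchron is *active* if its leaf is $(\underline{\alpha}P)$, and *necessary* unless its leaf is $(\underline{b?}P)$ or $(b{:})$. Synchrons $\varsigma,\upsilon$ are *concurrent* if $\varsigma=\sigma|_D\varsigma'$ and $\upsilon=\sigma|_E\upsilon'$ with $\{D,E\}=\{\mathrm L,\mathrm R\}$; then $\varsigma@\upsilon:=static(\sigma)|_D\varsigma'$, where $static$ deletes all arguments $+_{\mathrm L},+_{\mathrm R},A{:},\hat{\ }r$. A synchron is *unaffected* by $w$ if it is concurrent with all active synchrons of $w$; in that case $\varsigma@w:=\varsigma@\upsilon$, with $\upsilon$ an active synchron of $w$ having the longest prefix in common with $\varsigma$, if $\ell(w)\in Act$, and $\varsigma@w:=\varsigma$ otherwise. **The relation $\leadsto'$** (possible successor): $t\leadsto'_wt'$ iff (i) $src(t)=src(w)$; (ii) $src(t')=tgt(w)$; (iii) all necessary synchrons of $t$ are unaffected by $w$; (iv) $\varsigma@w\in\varsigma(t')$ for all $\varsigma\in\varsigma(t)$ that are unaffected by $w$; (v) $\ell(t)=\ell(t')$ or $\{\ell(t),\ell(t')\}=\{b?,b{:}\}$ for some $b\in\mathcal B$. **Theorem.**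 For all transitions $\chi,\zeta,\chi'$ of ABCdE: 1. if $\chi\leadsto_\zeta\chi'$ then $\chi\leadsto'_\zeta\chi'$; 2. if $\chi\leadsto'_\zeta\chi'$, and each relabelling $f$ for which $[f]$ occurs in a synchron of $\chi$ is injective on $\mathcal B$, then $\chi\leadsto_\zeta\chi'$. In particular, $\leadsto$ and $\leadsto'$ coincide if only relabellings that are injective on broadcast names are used (relabellings of handshake names and signals being arbitrary). -/

import Mathlib

namespace ABCdE

/-! ### Syntax

The language is parametrised by agent identifiers `A`, handshake names `C`, broadcast names `B`
and signals `S`. -/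

/-- The actions: handshake names and co-names, the internal action, broadcasts `b!`,
receives `b?`, and the reading of a signal. -/
inductive Act (C B S : Type*) where
  | name (c : C)
  | coname (c : C)
  | tau
  | bang (b : B)
  | recv (b : B)
  | read (s : S)

/-- Transition labels: actions, discards `b:`, and signal emissions. -/
inductive Lab (C B S : Type*) where
  | act (α : Act C B S)
  | disc (b : B)
  | emit (s : S)

/-- Relabellings: functions mapping each of the three sorts of names to itself. -/
structure Relabelling (C B S : Type*) where
  onC : C → C
  onB : B → B
  onS : S → S

/-- Process expressions. -/
inductive Proc (A C B S : Type*) where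
  | nil
  | pre (α : Act C B S) (P : Proc A C B S)
  | sum (P Q : Proc A C B S)
  | par (P Q : Proc A C B S)
  | res (P : Proc A C B S) (L : Set (C ⊕ S))
  | rel (P : Proc A C B S) (f : Relabelling C B S)
  | agent (X : A)
  | signal (P : Proc A C B S) (s : S)

/-- Each agent identifier occurs within the scope of an action prefix. -/
def Proc.Guarded {A C B S : Type*} : Proc A C B S → Prop
  | .nil => True
  | .pre _ _ => True
  | .sum P Q => P.Guarded ∧ Q.Guarded
  | .par P Q => P.Guarded ∧ Q.Guarded
  | .res P _ => P.Guarded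
  | .rel P _ => P.Guarded
  | .agent _ => False
  | .signal P _ => P.Guarded

/-- A defining equation, with a guarded body, for each agent identifier. -/
structure DefEqs (A C B S : Type*) where
  body : A → Proc A C B S
  guarded : ∀ X, (body X).Guarded

/-! ### Labels -/

namespace Lab

/-- The label is an action. -/
def IsAct {C B S : Type*} : Lab C B S → Prop
  | .act _ => True
  | .disc _ => False
  | .emit _ => False

/-- The label is a signal emission. -/
def IsEmit {C B S : Type*} : Lab C B S → Prop
  | .emit _ => True
  | _ => False

/-- The labels ranged over by `η`: all labels not of the form `b!`, `b?` or `b:`. -/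
def IsEta {C B S : Type*} : Lab C B S → Prop
  | .act (.bang _) => False
  | .act (.recv _) => False
  | .disc _ => False
  | _ => True

/-- `Compl c c'`: `c` is a handshake name, a handshake co-name, a signal or a signal emission,
and `c'` is its complement. -/
inductive Compl {C B S : Type*} : Lab C B S → Lab C B S → Prop
  | name (c : C) : Compl (.act (.name c)) (.act (.coname c))
  | coname (c : C) : Compl (.act (.coname c)) (.act (.name c))
  | read (s : S) : Compl (.act (.read s)) (.emit s)
  | emit (s : S) : Compl (.emit s) (.act (.read s))

/-- The label is in `L` or is the complement of an element of `L`. -/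
def Restricted {C B S : Type*} (L : Set (C ⊕ S)) : Lab C B S → Prop
  | .act (.name c) => Sum.inl c ∈ L
  | .act (.coname c) => Sum.inl c ∈ L
  | .act (.read s) => Sum.inr s ∈ L
  | .emit s => Sum.inr s ∈ L
  | _ => False

/-- `ℓ` is `b?` or `b:`. -/
def IsRecvOrDisc {C B S : Type*} (b : B) (ℓ : Lab C B S) : Prop :=
  ℓ = .act (.recv b) ∨ ℓ = .disc b

/-- `Bro ℓ₁ ℓ₂ ℓ`: for some `b` one has `ℓ₁ = b♯₁`, `ℓ₂ = b♯₂` and `ℓ = b♯`, where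
`♯ = ♯₁ ∘ ♯₂` is defined. -/
inductive Bro {C B S : Type*} : Lab C B S → Lab C B S → Lab C B S → Prop
  | bang_recv (b : B) : Bro (.act (.bang b)) (.act (.recv b)) (.act (.bang b))
  | bang_disc (b : B) : Bro (.act (.bang b)) (.disc b) (.act (.bang b))
  | recv_bang (b : B) : Bro (.act (.recv b)) (.act (.bang b)) (.act (.bang b))
  | recv_recv (b : B) : Bro (.act (.recv b)) (.act (.recv b)) (.act (.recv b))
  | recv_disc (b : B) : Bro (.act (.recv b)) (.disc b) (.act (.recv b))
  | disc_bang (b : B) : Bro (.disc b) (.act (.bang b)) (.act (.bang b))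
  | disc_recv (b : B) : Bro (.disc b) (.act (.recv b)) (.act (.recv b))
  | disc_disc (b : B) : Bro (.disc b) (.disc b) (.disc b)

end Lab

/-- The extension of a relabelling to labels. -/
def Relabelling.lab {C B S : Type*} (f : Relabelling C B S) : Lab C B S → Lab C B S
  | .act (.name c) => .act (.name (f.onC c))
  | .act (.coname c) => .act (.coname (f.onC c))
  | .act .tau => .act .tau
  | .act (.bang b) => .act (.bang (f.onB b))
  | .act (.recv b) => .act (.recv (f.onB b))
  | .act (.read s) => .act (.read (f.onS s))
  | .disc b => .disc (f.onB b)
  | .emit s => .emit (f.onS s)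

/-! ### Derivations, their names, and transitions -/

/-- `Deriv E P ℓ Q` is the type of derivations of the transition triple `P --ℓ--> Q`;
there is one constructor for each rule of the structural operational semantics. -/
inductive Deriv {A C B S : Type*} (E : DefEqs A C B S) :
    Proc A C B S → Lab C B S → Proc A C B S → Type _
  -- basic rules
  | act (α : Act C B S) (P : Proc A C B S) : Deriv E (.pre α P) (.act α) P
  | sumL {P P' : Proc A C B S} {α : Act C B S} (t : Deriv E P (.act α) P') (Q : Proc A C B S) :
      Deriv E (.sum P Q) (.act α) P'
  | sumR (P : Proc A C B S) {Q Q' : Proc A C B S} {α : Act C B S} (u : Deriv E Q (.act α) Q') :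
      Deriv E (.sum P Q) (.act α) Q'
  | parL {P P' : Proc A C B S} {η : Lab C B S} (t : Deriv E P η P') (Q : Proc A C B S)
      (h : η.IsEta) : Deriv E (.par P Q) η (.par P' Q)
  | comm {P P' Q Q' : Proc A C B S} {c c' : Lab C B S} (t : Deriv E P c P') (u : Deriv E Q c' Q')
      (h : Lab.Compl c c') : Deriv E (.par P Q) (.act .tau) (.par P' Q')
  | parR (P : Proc A C B S) {Q Q' : Proc A C B S} {η : Lab C B S} (u : Deriv E Q η Q')
      (h : η.IsEta) : Deriv E (.par P Q) η (.par P Q')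
  | res {P P' : Proc A C B S} {ℓ : Lab C B S} (t : Deriv E P ℓ P') (L : Set (C ⊕ S))
      (h : ¬ ℓ.Restricted L) : Deriv E (.res P L) ℓ (.res P' L)
  | rel {P P' : Proc A C B S} {ℓ : Lab C B S} (t : Deriv E P ℓ P') (f : Relabelling C B S) :
      Deriv E (.rel P f) (f.lab ℓ) (.rel P' f)
  | unfold (X : A) {P' : Proc A C B S} {α : Act C B S} (t : Deriv E (E.body X) (.act α) P') :
      Deriv E (.agent X) (.act α) P'
  -- broadcast rules
  | disNil (b : B) : Deriv E .nil (.disc b) .nil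
  | disAct (b : B) (α : Act C B S) (P : Proc A C B S) (h : α ≠ .recv b) :
      Deriv E (.pre α P) (.disc b) (.pre α P)
  | disSum {P P' Q Q' : Proc A C B S} {b : B} (t : Deriv E P (.disc b) P')
      (u : Deriv E Q (.disc b) Q') : Deriv E (.sum P Q) (.disc b) (.sum P' Q')
  | bro {P P' Q Q' : Proc A C B S} {ℓ₁ ℓ₂ ℓ : Lab C B S} (t : Deriv E P ℓ₁ P')
      (u : Deriv E Q ℓ₂ Q') (h : Lab.Bro ℓ₁ ℓ₂ ℓ) : Deriv E (.par P Q) ℓ (.par P' Q')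
  | disRec (X : A) {P' : Proc A C B S} {b : B} (t : Deriv E (E.body X) (.disc b) P') :
      Deriv E (.agent X) (.disc b) (.agent X)
  -- signal rules
  | sig (P : Proc A C B S) (s : S) : Deriv E (.signal P s) (.emit s) (.signal P s)
  | sigSumL {P P' : Proc A C B S} {s : S} (t : Deriv E P (.emit s) P') (Q : Proc A C B S) :
      Deriv E (.sum P Q) (.emit s) (.sum P' Q)
  | sigSumR (P : Proc A C B S) {Q Q' : Proc A C B S} {s : S} (u : Deriv E Q (.emit s) Q') :
      Deriv E (.sum P Q) (.emit s) (.sum P Q')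
  | sigSig {P P' : Proc A C B S} {s : S} (t : Deriv E P (.emit s) P') (r : S) :
      Deriv E (.signal P r) (.emit s) (.signal P' r)
  | sigRec (X : A) {P' : Proc A C B S} {s : S} (t : Deriv E (E.body X) (.emit s) P') :
      Deriv E (.agent X) (.emit s) (.agent X)
  | actSig {P P' : Proc A C B S} {α : Act C B S} (t : Deriv E P (.act α) P') (r : S) :
      Deriv E (.signal P r) (.act α) P'
  | disSig {P P' : Proc A C B S} {b : B} (t : Deriv E P (.disc b) P') (r : S) :
      Deriv E (.signal P r) (.disc b) (.signal P' r)

/-- The expressions that serve as names of derivations. -/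
inductive Name (A C B S : Type*) where
  /-- the name of the execution of the prefix of `α.P` -/
  | act (α : Act C B S) (P : Proc A C B S)
  /-- `b:0` -/
  | disNil (b : B)
  /-- `b:α.P` -/
  | disAct (b : B) (α : Act C B S) (P : Proc A C B S)
  /-- `t + Q` -/
  | sumL (t : Name A C B S) (Q : Proc A C B S)
  /-- `P + u` -/
  | sumR (P : Proc A C B S) (u : Name A C B S)
  /-- `t + u` -/
  | sum (t u : Name A C B S)
  /-- `t | Q` -/
  | parL (t : Name A C B S) (Q : Proc A C B S)
  /-- `P | u` -/
  | parR (P : Proc A C B S) (u : Name A C B S)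
  /-- `t | u` -/
  | par (t u : Name A C B S)
  /-- `t \ L` -/
  | res (t : Name A C B S) (L : Set (C ⊕ S))
  /-- `t [f]` -/
  | rel (t : Name A C B S) (f : Relabelling C B S)
  /-- `X : t` -/
  | agent (X : A) (t : Name A C B S)
  /-- the name of the emission of `s` by `P ^ s` -/
  | sig (P : Proc A C B S) (s : S)
  /-- `t ^ r` -/
  | signal (t : Name A C B S) (r : S)

/-- The name of a derivation. -/
def Deriv.toName {A C B S : Type*} {E : DefEqs A C B S} {P : Proc A C B S} {ℓ : Lab C B S}
    {Q : Proc A C B S} : Deriv E P ℓ Q → Name A C B S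
  | .act α P => .act α P
  | .sumL t Q => .sumL t.toName Q
  | .sumR P u => .sumR P u.toName
  | .parL t Q _ => .parL t.toName Q
  | .comm t u _ => .par t.toName u.toName
  | .parR P u _ => .parR P u.toName
  | .res t L _ => .res t.toName L
  | .rel t f => .rel t.toName f
  | .unfold X t => .agent X t.toName
  | .disNil b => .disNil b
  | .disAct b α P _ => .disAct b α P
  | .disSum t u => .sum t.toName u.toName
  | .bro t u _ => .par t.toName u.toName
  | .disRec X t => .agent X t.toName
  | .sig P s => .sig P s
  | .sigSumL t Q => .sumL t.toName Q
  | .sigSumR P u => .sumR P u.toName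
  | .sigSig t r => .signal t.toName r
  | .sigRec X t => .agent X t.toName
  | .actSig t r => .signal t.toName r
  | .disSig t r => .signal t.toName r

/-- Transitions: derivations of transition triples, with their source, label and target. -/
structure Tr {A C B S : Type*} (E : DefEqs A C B S) where
  src : Proc A C B S
  lab : Lab C B S
  tgt : Proc A C B S
  deriv : Deriv E src lab tgt

/-- The name of a transition. -/
def Tr.name {A C B S : Type*} {E : DefEqs A C B S} (t : Tr E) : Name A C B S := t.deriv.toName

/-- A derivation is determined by its name. -/
theorem Deriv.toName_inj {A C B S : Type*} {E : DefEqs A C B S} {P : Proc A C B S} {ℓ : Lab C B S}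
    {Q : Proc A C B S} (d : Deriv E P ℓ Q) :
    ∀ {P' ℓ' Q'} (d' : Deriv E P' ℓ' Q'), d.toName = d'.toName →
      (⟨P, ℓ, Q, d⟩ : Tr E) = ⟨P', ℓ', Q', d'⟩ := by
  induction d with
  | comm t u h iht ihu | bro t u h iht ihu =>
    intro P' ℓ' Q' d' h'
    cases d' <;> simp only [Deriv.toName, reduceCtorEq, Name.par.injEq] at h'
    all_goals
      have h1 := iht _ h'.1
      have h2 := ihu _ h'.2
      injection h1 with a1 a2 a3 a4
      injection h2 with b1 b2 b3 b4
      subst a1 a2 a3 b1 b2 b3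
      cases a4; cases b4
      first
      | (rename_i hh; cases h <;> cases hh <;> rfl)
  | disSum t u iht ihu =>
    intro P' ℓ' Q' d' h'
    cases d' <;> simp only [Deriv.toName, reduceCtorEq, Name.sum.injEq] at h'
    have h1 := iht _ h'.1
    have h2 := ihu _ h'.2
    injection h1 with a1 a2 a3 a4
    injection h2 with b1 b2 b3 b4
    subst a1 a3 b1 b3
    cases a2
    cases a4; cases b4; rfl
  | act | disNil | disAct | sig =>
    intro P' ℓ' Q' d' h'
    cases d' <;> simp only [Deriv.toName, reduceCtorEq, Name.act.injEq, Name.disNil.injEq,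
      Name.disAct.injEq, Name.sig.injEq] at h'
    all_goals (obtain ⟨rfl, rfl, rfl⟩ := h'; rfl)
  | sumL t _ ih | sumR _ t ih | parL t _ _ ih | parR _ t _ ih | res t _ _ ih | rel t _ ih
  | unfold _ t ih | disRec _ t ih | sigSumL t _ ih | sigSumR _ t ih | sigSig t _ ih | sigRec _ t ih
  | actSig t _ ih | disSig t _ ih =>
    intro P' ℓ' Q' d' h'
    cases d' <;> simp only [Deriv.toName, reduceCtorEq, Name.sumL.injEq, Name.sumR.injEq, Name.parL.injEq,
      Name.parR.injEq, Name.res.injEq, Name.rel.injEq, Name.agent.injEq, Name.signal.injEq] at h'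
    all_goals
      obtain ⟨h1, h2⟩ := h'
      try subst h1
      try subst h2
      first
      | have h1 := ih _ h1
      | have h1 := ih _ h2
      simp only [Tr.mk.injEq] at h1
      obtain ⟨a1, a2, a3, a4⟩ := h1
      first | subst a1 | skip
      subst a3
      first
      | (subst a2; cases a4; rfl)
      | (cases a2; cases a4; rfl)
      | cases a2

theorem Tr.name_injective {A C B S : Type*} {E : DefEqs A C B S} :
    Function.Injective (Tr.name : Tr E → Name A C B S) :=
  fun t t' h => t.deriv.toName_inj t'.deriv h

/-! ### The inductively defined successor relation -/

/-- `LeadsTo χ ζ χ'` is the inductively defined successor relation `χ ↝_ζ χ'`.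
A composed transition, such as `t + Q`, is referred to by its name; thus `χ.name = .sumL t.name Q`
says that the composed transition `t + Q` exists and equals `χ`. -/
inductive LeadsTo {A C B S : Type*} {E : DefEqs A C B S} : Tr E → Tr E → Tr E → Prop
  | passive {χ ζ : Tr E} (hζ : ¬ ζ.lab.IsAct) (hs : ζ.src = χ.src) : LeadsTo χ ζ χ
  | recv {χ ζ t : Tr E} {b : B} {P : Proc A C B S}
      (hχ : χ.name = .act (.recv b) P) (hζ : ζ.name = .act (.recv b) P)
      (ht : t.src = P) (hl : t.lab.IsRecvOrDisc b) : LeadsTo χ ζ t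
  | disc {χ ζ t : Tr E} {b : B} {α : Act C B S} {P : Proc A C B S}
      (hχ : χ.name = .disAct b α P) (hζ : ζ.name = .act α P)
      (ht : t.src = P) (hl : t.lab.IsRecvOrDisc b) : LeadsTo χ ζ t
  | sumLL {χ ζ t v t' : Tr E} {Q : Proc A C B S}
      (hχ : χ.name = .sumL t.name Q) (hζ : ζ.name = .sumL v.name Q)
      (hs : t.src = v.src) (ht' : t'.src = v.tgt) (hv : ¬ v.lab.IsEmit)
      (h : LeadsTo t v t') : LeadsTo χ ζ t'
  | sumBL {χ ζ t u v t' : Tr E}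
      (hχ : χ.name = .sum t.name u.name) (hζ : ζ.name = .sumL v.name u.src)
      (hs : t.src = v.src) (ht' : t'.src = v.tgt) (hv : ¬ v.lab.IsEmit)
      (h : LeadsTo t v t') : LeadsTo χ ζ t'
  | sumRR {χ ζ u w u' : Tr E} {P : Proc A C B S}
      (hχ : χ.name = .sumR P u.name) (hζ : ζ.name = .sumR P w.name)
      (hs : u.src = w.src) (hu' : u'.src = w.tgt) (hw : ¬ w.lab.IsEmit)
      (h : LeadsTo u w u') : LeadsTo χ ζ u'
  | sumBR {χ ζ t u w u' : Tr E}
      (hχ : χ.name = .sum t.name u.name) (hζ : ζ.name = .sumR t.src w.name)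
      (hs : u.src = w.src) (hu' : u'.src = w.tgt) (hw : ¬ w.lab.IsEmit)
      (h : LeadsTo u w u') : LeadsTo χ ζ u'
  | sumLR {χ ζ t w u' : Tr E} {b : B}
      (hχ : χ.name = .sumL t.name w.src) (hζ : ζ.name = .sumR t.src w.name)
      (hu' : u'.src = w.tgt) (hw : ¬ w.lab.IsEmit)
      (hb : t.lab = .act (.recv b)) (hl : u'.lab.IsRecvOrDisc b) : LeadsTo χ ζ u'
  | sumRL {χ ζ u v t' : Tr E} {b : B}
      (hχ : χ.name = .sumR v.src u.name) (hζ : ζ.name = .sumL v.name u.src)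
      (ht' : t'.src = v.tgt) (hv : ¬ v.lab.IsEmit)
      (hb : u.lab = .act (.recv b)) (hl : t'.lab.IsRecvOrDisc b) : LeadsTo χ ζ t'
  | parLR {χ ζ χ' t w : Tr E}
      (hχ : χ.name = .parL t.name w.src) (hζ : ζ.name = .parR t.src w.name)
      (hχ' : χ'.name = .parL t.name w.tgt) : LeadsTo χ ζ χ'
  | parRL {χ ζ χ' u v : Tr E}
      (hχ : χ.name = .parR v.src u.name) (hζ : ζ.name = .parL v.name u.src)
      (hχ' : χ'.name = .parR v.tgt u.name) : LeadsTo χ ζ χ'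
  | parLL {χ ζ χ' t v t' : Tr E} {Q : Proc A C B S}
      (hχ : χ.name = .parL t.name Q) (hζ : ζ.name = .parL v.name Q)
      (hχ' : χ'.name = .parL t'.name Q)
      (hs : t.src = v.src) (ht' : t'.src = v.tgt)
      (h : LeadsTo t v t') : LeadsTo χ ζ χ'
  | parLB {χ ζ χ' t v w t' : Tr E}
      (hχ : χ.name = .parL t.name w.src) (hζ : ζ.name = .par v.name w.name)
      (hχ' : χ'.name = .parL t'.name w.tgt)
      (hs : t.src = v.src) (ht' : t'.src = v.tgt)
      (h : LeadsTo t v t') : LeadsTo χ ζ χ'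
  | parBL {χ ζ χ' t u v t' : Tr E}
      (hχ : χ.name = .par t.name u.name) (hζ : ζ.name = .parL v.name u.src)
      (hχ' : χ'.name = .par t'.name u.name)
      (hs : t.src = v.src) (ht' : t'.src = v.tgt)
      (h : LeadsTo t v t') : LeadsTo χ ζ χ'
  | parRR {χ ζ χ' u w u' : Tr E} {P : Proc A C B S}
      (hχ : χ.name = .parR P u.name) (hζ : ζ.name = .parR P w.name)
      (hχ' : χ'.name = .parR P u'.name)
      (hs : u.src = w.src) (hu' : u'.src = w.tgt)
      (h : LeadsTo u w u') : LeadsTo χ ζ χ'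
  | parRB {χ ζ χ' u v w u' : Tr E}
      (hχ : χ.name = .parR v.src u.name) (hζ : ζ.name = .par v.name w.name)
      (hχ' : χ'.name = .parR v.tgt u'.name)
      (hs : u.src = w.src) (hu' : u'.src = w.tgt)
      (h : LeadsTo u w u') : LeadsTo χ ζ χ'
  | parBR {χ ζ χ' t u w u' : Tr E}
      (hχ : χ.name = .par t.name u.name) (hζ : ζ.name = .parR t.src w.name)
      (hχ' : χ'.name = .par t.name u'.name)
      (hs : u.src = w.src) (hu' : u'.src = w.tgt)
      (h : LeadsTo u w u') : LeadsTo χ ζ χ'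
  | parBB {χ ζ χ' t u v w t' u' : Tr E}
      (hχ : χ.name = .par t.name u.name) (hζ : ζ.name = .par v.name w.name)
      (hχ' : χ'.name = .par t'.name u'.name)
      (hst : t.src = v.src) (ht' : t'.src = v.tgt)
      (hsu : u.src = w.src) (hu' : u'.src = w.tgt)
      (ht : LeadsTo t v t') (hu : LeadsTo u w u') : LeadsTo χ ζ χ'
  | res {χ ζ χ' t v t' : Tr E} {L : Set (C ⊕ S)}
      (hχ : χ.name = .res t.name L) (hζ : ζ.name = .res v.name L)
      (hχ' : χ'.name = .res t'.name L)
      (hs : t.src = v.src) (ht' : t'.src = v.tgt) (hv : v.lab.IsAct)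
      (h : LeadsTo t v t') : LeadsTo χ ζ χ'
  | rel {χ ζ χ' t v t' : Tr E} {f : Relabelling C B S}
      (hχ : χ.name = .rel t.name f) (hζ : ζ.name = .rel v.name f)
      (hχ' : χ'.name = .rel t'.name f)
      (hs : t.src = v.src) (ht' : t'.src = v.tgt) (hv : v.lab.IsAct)
      (h : LeadsTo t v t') : LeadsTo χ ζ χ'
  | agent {χ ζ t v t' : Tr E} {X : A}
      (hχ : χ.name = .agent X t.name) (hζ : ζ.name = .agent X v.name)
      (hs : t.src = v.src) (ht' : t'.src = v.tgt) (hv : v.lab.IsAct)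
      (h : LeadsTo t v t') : LeadsTo χ ζ t'
  | signal {χ ζ t v t' : Tr E} {r : S}
      (hχ : χ.name = .signal t.name r) (hζ : ζ.name = .signal v.name r)
      (hs : t.src = v.src) (ht' : t'.src = v.tgt) (hv : v.lab.IsAct)
      (h : LeadsTo t v t') : LeadsTo χ ζ t'

/-! ### Synchrons -/

/-- The two sides of a binary operator. -/
inductive Side where
  | left
  | right

/-- Arguments, recording through which operator a path in a derivation passes. -/
inductive Arg (A C B S : Type*) where
  | sum (D : Side)
  | par (D : Side)
  | res (L : Set (C ⊕ S))
  | rel (f : Relabelling C B S)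
  | agent (X : A)
  | signal (r : S)

/-- The leaf at the end of a synchron. -/
inductive Leaf (A C B S : Type*) where
  | act (α : Act C B S) (P : Proc A C B S)
  | disc (b : B)
  | sig (P : Proc A C B S) (s : S)

/-- A synchron: a sequence of arguments, outermost first, followed by a leaf. -/
@[ext] structure Synchron (A C B S : Type*) where
  args : List (Arg A C B S)
  leaf : Leaf A C B S

/-- Application of an argument to a synchron. -/
def Synchron.cons {A C B S : Type*} (ι : Arg A C B S) (ς : Synchron A C B S) :
    Synchron A C B S := ⟨ι :: ς.args, ς.leaf⟩

/-- The set of synchrons of a derivation, by recursion on its name. -/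
def Name.synchrons {A C B S : Type*} : Name A C B S → Set (Synchron A C B S)
  | .act α P => {⟨[], .act α P⟩}
  | .disNil b => {⟨[], .disc b⟩}
  | .disAct b _ _ => {⟨[], .disc b⟩}
  | .sumL t _ => Synchron.cons (.sum .left) '' t.synchrons
  | .sumR _ u => Synchron.cons (.sum .right) '' u.synchrons
  | .sum t u =>
      Synchron.cons (.sum .left) '' t.synchrons ∪ Synchron.cons (.sum .right) '' u.synchrons
  | .parL t _ => Synchron.cons (.par .left) '' t.synchrons
  | .parR _ u => Synchron.cons (.par .right) '' u.synchrons
  | .par t u =>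
      Synchron.cons (.par .left) '' t.synchrons ∪ Synchron.cons (.par .right) '' u.synchrons
  | .res t L => Synchron.cons (.res L) '' t.synchrons
  | .rel t f => Synchron.cons (.rel f) '' t.synchrons
  | .agent X t => Synchron.cons (.agent X) '' t.synchrons
  | .sig P s => {⟨[], .sig P s⟩}
  | .signal t r => Synchron.cons (.signal r) '' t.synchrons

/-- The set of synchrons of a transition. -/
def Tr.synchrons {A C B S : Type*} {E : DefEqs A C B S} (t : Tr E) : Set (Synchron A C B S) :=
  t.name.synchrons

/-- A synchron is active if it executes an action prefix. -/
def Synchron.Active {A C B S : Type*} (ς : Synchron A C B S) : Prop :=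
  ∃ α P, ς.leaf = .act α P

/-- A synchron is necessary unless its leaf receives or discards a broadcast. -/
def Synchron.Necessary {A C B S : Type*} (ς : Synchron A C B S) : Prop :=
  ¬ ((∃ b P, ς.leaf = .act (.recv b) P) ∨ ∃ b, ς.leaf = .disc b)

/-- The active synchrons of a transition. -/
def Tr.activeSynchrons {A C B S : Type*} {E : DefEqs A C B S} (t : Tr E) :
    Set (Synchron A C B S) := {ς ∈ t.synchrons | ς.Active}

/-- The necessary synchrons of a transition. -/
def Tr.necessarySynchrons {A C B S : Type*} {E : DefEqs A C B S} (t : Tr E) :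
    Set (Synchron A C B S) := {ς ∈ t.synchrons | ς.Necessary}

/-- Two synchrons are concurrent if they first diverge at opposite sides of a parallel
composition. -/
def Synchron.Conc {A C B S : Type*} (ς υ : Synchron A C B S) : Prop :=
  ∃ (σ : List (Arg A C B S)) (D D' : Side) (σ₁ σ₂ : List (Arg A C B S)), D ≠ D' ∧
    ς.args = σ ++ .par D :: σ₁ ∧ υ.args = σ ++ .par D' :: σ₂

/-- A synchron is unaffected by a transition. -/
def Synchron.Unaffected {A C B S : Type*} {E : DefEqs A C B S} (ς : Synchron A C B S)
    (w : Tr E) : Prop := ∀ υ ∈ w.activeSynchrons, ς.Conc υ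

/-- A transition is unaffected by a transition. -/
def Tr.Unaffected {A C B S : Type*} {E : DefEqs A C B S} (t w : Tr E) : Prop :=
  t.src = w.src ∧ ∀ ς ∈ t.necessarySynchrons, ς.Unaffected w

/-! ### The after-function -/

/-- The dynamic arguments are those of choice, recursion and signalling;
the other ones are static. -/
def Arg.isStatic {A C B S : Type*} : Arg A C B S → Bool
  | .sum _ => false
  | .agent _ => false
  | .signal _ => false
  | .par _ => true
  | .res _ => true
  | .rel _ => true

/-- Removal of all dynamic arguments. -/
def static {A C B S : Type*} (σ : List (Arg A C B S)) : List (Arg A C B S) :=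
  σ.filter Arg.isStatic

open Classical in
/-- The largest common initial part of two lists. -/
noncomputable def common {α : Type*} : List α → List α → List α
  | a :: σ, b :: τ => if a = b then a :: common σ τ else []
  | _, _ => []

/-- `ς.after υ` is `ς @ υ`, meant for concurrent `ς` and `υ`: if `ς = σ |_D ς'` and
`υ = σ |_E υ'` with `D ≠ E`, then it is `static(σ) |_D ς'`; see `Synchron.after_eq`. -/
noncomputable def Synchron.after {A C B S : Type*} (ς υ : Synchron A C B S) :
    Synchron A C B S :=
  ⟨static (common ς.args υ.args) ++ ς.args.drop (common ς.args υ.args).length, ς.leaf⟩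

theorem common_append {α : Type*} (σ : List α) {a b : α} (h : a ≠ b) (σ₁ σ₂ : List α) :
    common (σ ++ a :: σ₁) (σ ++ b :: σ₂) = σ := by
  induction σ with
  | nil => simp [common, h]
  | cons c σ ih => simp [common, ih]

theorem Synchron.after_eq {A C B S : Type*} {ς υ : Synchron A C B S}
    {σ σ₁ σ₂ : List (Arg A C B S)} {D D' : Side} (h : D ≠ D')
    (hς : ς.args = σ ++ .par D :: σ₁) (hυ : υ.args = σ ++ .par D' :: σ₂) :
    ς.after υ = ⟨static σ ++ .par D :: σ₁, ς.leaf⟩ := by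
  have hc : common ς.args υ.args = σ := by
    rw [hς, hυ]; exact common_append σ (by simpa using h) σ₁ σ₂
  simp only [Synchron.after, hc]
  simp [hς]

/-- `υ` is an active synchron of `w` that is closest to `ς`: it has the largest initial part in
common with `ς`. -/
def Synchron.IsClosest {A C B S : Type*} {E : DefEqs A C B S} (ς : Synchron A C B S) (w : Tr E)
    (υ : Synchron A C B S) : Prop :=
  υ ∈ w.activeSynchrons ∧ ∀ υ' ∈ w.activeSynchrons,
    (common ς.args υ'.args).length ≤ (common ς.args υ.args).length

open Classical in
/-- `ς.afterTr w` is `ς @ w`, meant for `ς` unaffected by `w`. If the label of `w` is an action,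
then a closest active synchron exists (`Tr.exists_isClosest`). -/
noncomputable def Synchron.afterTr {A C B S : Type*} {E : DefEqs A C B S}
    (ς : Synchron A C B S) (w : Tr E) : Synchron A C B S :=
  if h : w.lab.IsAct ∧ ∃ υ, ς.IsClosest w υ then ς.after h.2.choose else ς

/-- A transition labelled with an action has an active synchron. -/
theorem Tr.activeSynchrons_nonempty {A C B S : Type*} {E : DefEqs A C B S} (w : Tr E)
    (hw : w.lab.IsAct) : w.activeSynchrons.Nonempty := by
  obtain ⟨P, ℓ, Q, d⟩ := w
  suffices h : ∃ ς ∈ d.toName.synchrons, ς.Active from h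
  change ℓ.IsAct at hw
  induction d with
  | act α P => exact ⟨_, rfl, α, P, rfl⟩
  | disNil | disAct | disSum | disRec | sig | sigSumL | sigSumR | sigSig | sigRec | disSig =>
    exact absurd hw (by simp [Lab.IsAct])
  | sumL t Q ih | sumR P t ih | parL t Q h ih | parR P t h ih | res t L h ih | unfold X t ih
  | actSig t r ih =>
    obtain ⟨ς, hς, α, R, hl⟩ := ih hw
    exact ⟨_, ⟨ς, hς, rfl⟩, α, R, hl⟩
  | @rel P P' ℓ t f ih =>
    have hℓ : ℓ.IsAct := by
      rcases ℓ with α | b | s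
      · trivial
      · exact hw
      · exact hw
    obtain ⟨ς, hς, α, R, hl⟩ := ih hℓ
    exact ⟨_, ⟨ς, hς, rfl⟩, α, R, hl⟩
  | comm t u h iht ihu =>
    cases h with
    | name | coname | read =>
      obtain ⟨ς, hς, α, R, hl⟩ := iht trivial
      exact ⟨_, Or.inl ⟨ς, hς, rfl⟩, α, R, hl⟩
    | emit =>
      obtain ⟨ς, hς, α, R, hl⟩ := ihu trivial
      exact ⟨_, Or.inr ⟨ς, hς, rfl⟩, α, R, hl⟩
  | bro t u h iht ihu =>
    cases h with
    | bang_recv | bang_disc | recv_bang | recv_recv | recv_disc =>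
      obtain ⟨ς, hς, α, R, hl⟩ := iht trivial
      exact ⟨_, Or.inl ⟨ς, hς, rfl⟩, α, R, hl⟩
    | disc_bang | disc_recv =>
      obtain ⟨ς, hς, α, R, hl⟩ := ihu trivial
      exact ⟨_, Or.inr ⟨ς, hς, rfl⟩, α, R, hl⟩
    | disc_disc => exact absurd hw (by simp [Lab.IsAct])

theorem common_length_le {α : Type*} (σ τ : List α) : (common σ τ).length ≤ σ.length := by
  induction σ generalizing τ with
  | nil => simp [common]
  | cons a σ ih =>
    cases τ with
    | nil => simp [common]
    | cons b τ =>
      simp only [common]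
      split_ifs
      · simpa using ih τ
      · simp

/-- A transition labelled with an action has a closest active synchron. -/
theorem Tr.exists_isClosest {A C B S : Type*} {E : DefEqs A C B S} (w : Tr E)
    (hw : w.lab.IsAct) (ς : Synchron A C B S) : ∃ υ, ς.IsClosest w υ := by
  by_contra! hno
  have key : ∀ n : ℕ, ∃ υ ∈ w.activeSynchrons, n ≤ (common ς.args υ.args).length := by
    intro n
    induction n with
    | zero =>
      obtain ⟨υ, hυ⟩ := w.activeSynchrons_nonempty hw
      exact ⟨υ, hυ, Nat.zero_le _⟩
    | succ n ih =>
      obtain ⟨υ, hυ, hn⟩ := ih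
      by_contra! hlt
      exact hno υ ⟨hυ, fun υ' hυ' => by have := hlt υ' hυ'; omega⟩
  obtain ⟨υ, -, hn⟩ := key (ς.args.length + 1)
  have := common_length_le ς.args υ.args
  omega

/-! ### The successor relation based on synchrons -/

/-- `PossibleSuccessor t w t'`: the transition `t'` is a possible successor of the transition `t`
after the transition `w`. -/
structure PossibleSuccessor {A C B S : Type*} {E : DefEqs A C B S} (t w t' : Tr E) : Prop where
  src_eq : t.src = w.src
  src_eq_tgt : t'.src = w.tgt
  unaffected : t.Unaffected w
  synchrons : ∀ ς ∈ t.synchrons, ς.Unaffected w → ς.afterTr w ∈ t'.synchrons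
  label : t.lab = t'.lab ∨
    ∃ b : B, ({t.lab, t'.lab} : Set (Lab C B S)) = {.act (.recv b), .disc b}

/-- Every relabelling operator applied in the derivation `t` is injective on broadcast names. -/
def Tr.RelabelsInjectively {A C B S : Type*} {E : DefEqs A C B S} (t : Tr E) : Prop :=
  ∀ ς ∈ t.synchrons, ∀ f : Relabelling C B S, .rel f ∈ ς.args → Function.Injective f.onB

end ABCdE

/-! The relation based on synchrons is global, the inductive one is structural; they are matched by
decomposing the former along the outermost operator. The two clauses about synchrons are bundled
into `Carry X w Y`, which splits over unions in `X`. For synchrons that start with an argument `ι`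
it reduces to a statement one level down. Either the active synchrons of `ζ` not on the opposite
side of a parallel composition come from a component `v` (`Under`), and carrying over `ζ` becomes
carrying over `v`; or all of them lie on that opposite side (`Beside`), and carrying becomes
inclusion. If `ζ` resolves a choice against `ι`, every synchron is affected, so carrying says that
none is necessary, that is, the component receives or discards. Through these equivalences one
direction is a rule induction and the other an induction on the name of `χ`.

The second direction meets two obstacles. First, the label clause only constrains the composite
transitions, while the induction needs it for the components. For this each synchron gets a label of
its own, that of its leaf relabelled along the path. The passage to `ς @ w` preserves it, because
only dynamic arguments are deleted and these do not relabel. `LabSpec` ties the label of a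
transition to those of its synchrons, so carried necessary synchrons restrict the successor's label
and, under a parallel composition, its shape. Nothing is learned this way about receives and
discards: a component receiving `b` may lose all its synchrons and be followed by one receiving
`b'`, and a relabelling identifying `b` with `b'` hides the difference. This is why injectivity on
broadcast names is needed, in `LabCarry.compat_of_relabel`.

Second, where `ζ` leaves a component or the whole state unchanged, the inductive relation demands
the very same transition, whereas synchrons only yield an inclusion with compatible labels.
`Tr.eq_of_synchrons_subset` shows that this forces equality. -/

namespace ABCdE

variable {A C B S : Type*} {E : DefEqs A C B S}

/-! ### Inversion of transitions -/

/-- `ℓ` is the label of a parallel composition in which both components, labelled `ℓ₁` and `ℓ₂`,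
take part. -/
def Lab.Comp (ℓ₁ ℓ₂ ℓ : Lab C B S) : Prop :=
  (Lab.Compl ℓ₁ ℓ₂ ∧ ℓ = .act .tau) ∨ Lab.Bro ℓ₁ ℓ₂ ℓ

theorem Relabelling.lab_isAct (f : Relabelling C B S) (ℓ : Lab C B S) :
    (f.lab ℓ).IsAct ↔ ℓ.IsAct := by
  rcases ℓ with (_ | _ | _ | _ | _ | _) | _ | _ <;> simp [Relabelling.lab, Lab.IsAct]

theorem Tr.of_name_act {χ : Tr E} {α : Act C B S} {P : Proc A C B S}
    (h : χ.name = .act α P) : χ.src = .pre α P ∧ χ.lab = .act α ∧ χ.tgt = P := by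
  obtain ⟨_, _, _, d⟩ := χ
  cases d <;> simp_all [Tr.name, Deriv.toName]

theorem Tr.of_name_disNil {χ : Tr E} {b : B} (h : χ.name = .disNil b) :
    χ.src = .nil ∧ χ.lab = .disc b := by
  obtain ⟨_, _, _, d⟩ := χ
  cases d <;> simp_all [Tr.name, Deriv.toName]

theorem Tr.of_name_disAct {χ : Tr E} {b : B} {α : Act C B S} {P : Proc A C B S}
    (h : χ.name = .disAct b α P) : χ.src = .pre α P ∧ χ.lab = .disc b := by
  obtain ⟨_, _, _, d⟩ := χ
  cases d <;> simp_all [Tr.name, Deriv.toName]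

theorem Tr.of_name_sig {χ : Tr E} {P : Proc A C B S} {s : S} (h : χ.name = .sig P s) :
    χ.src = .signal P s ∧ χ.lab = .emit s := by
  obtain ⟨_, _, _, d⟩ := χ
  cases d <;> simp_all [Tr.name, Deriv.toName]

theorem Deriv.eq_of_toName {P Q : Proc A C B S} {ℓ : Lab C B S} (d : Deriv E P ℓ Q) {t : Tr E}
    (h : d.toName = t.name) : t = ⟨P, ℓ, Q, d⟩ :=
  Tr.name_injective h.symm

/-- An action rule and a signal rule share this name. Only the action resolves the choice, so only
then do the targets agree; discards are absent because they need both summands. -/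
theorem Tr.of_name_sumL {χ t : Tr E} {Q : Proc A C B S} (h : χ.name = .sumL t.name Q) :
    χ.src = .sum t.src Q ∧ χ.lab = t.lab ∧ (t.lab.IsEmit ∨ t.lab.IsAct ∧ χ.tgt = t.tgt) := by
  obtain ⟨_, _, _, d⟩ := χ
  cases d <;> simp only [Tr.name, Deriv.toName, reduceCtorEq, Name.sumL.injEq] at h
  all_goals
    obtain ⟨h, rfl⟩ := h
    obtain rfl := Deriv.eq_of_toName _ h
    simp [Lab.IsAct, Lab.IsEmit]

theorem Tr.of_name_sumR {χ u : Tr E} {P : Proc A C B S} (h : χ.name = .sumR P u.name) :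
    χ.src = .sum P u.src ∧ χ.lab = u.lab ∧ (u.lab.IsEmit ∨ u.lab.IsAct ∧ χ.tgt = u.tgt) := by
  obtain ⟨_, _, _, d⟩ := χ
  cases d <;> simp only [Tr.name, Deriv.toName, reduceCtorEq, Name.sumR.injEq] at h
  all_goals
    obtain ⟨rfl, h⟩ := h
    obtain rfl := Deriv.eq_of_toName _ h
    simp [Lab.IsAct, Lab.IsEmit]

theorem Tr.of_name_sum {χ t u : Tr E} (h : χ.name = .sum t.name u.name) :
    χ.src = .sum t.src u.src ∧ ∃ b, χ.lab = .disc b ∧ t.lab = .disc b ∧ u.lab = .disc b := by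
  obtain ⟨_, _, _, d⟩ := χ
  cases d <;> simp only [Tr.name, Deriv.toName, reduceCtorEq, Name.sum.injEq] at h
  all_goals
    obtain ⟨h, h'⟩ := h
    obtain rfl := Deriv.eq_of_toName _ h
    obtain rfl := Deriv.eq_of_toName _ h'
    simp

theorem Tr.of_name_parL {χ t : Tr E} {Q : Proc A C B S} (h : χ.name = .parL t.name Q) :
    χ.src = .par t.src Q ∧ χ.lab = t.lab ∧ χ.tgt = .par t.tgt Q ∧ t.lab.IsEta := by
  obtain ⟨_, _, _, d⟩ := χ
  cases d <;> simp only [Tr.name, Deriv.toName, reduceCtorEq, Name.parL.injEq] at h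
  all_goals
    obtain ⟨h, rfl⟩ := h
    obtain rfl := Deriv.eq_of_toName _ h
    simpa

theorem Tr.of_name_parR {χ u : Tr E} {P : Proc A C B S} (h : χ.name = .parR P u.name) :
    χ.src = .par P u.src ∧ χ.lab = u.lab ∧ χ.tgt = .par P u.tgt ∧ u.lab.IsEta := by
  obtain ⟨_, _, _, d⟩ := χ
  cases d <;> simp only [Tr.name, Deriv.toName, reduceCtorEq, Name.parR.injEq] at h
  all_goals
    obtain ⟨rfl, h⟩ := h
    obtain rfl := Deriv.eq_of_toName _ h
    simpa

/-- Handshakes and broadcasts share this name, which is why `Lab.Comp` covers both. -/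
theorem Tr.of_name_par {χ t u : Tr E} (h : χ.name = .par t.name u.name) :
    χ.src = .par t.src u.src ∧ Lab.Comp t.lab u.lab χ.lab ∧ χ.tgt = .par t.tgt u.tgt := by
  obtain ⟨_, _, _, d⟩ := χ
  cases d <;> simp only [Tr.name, Deriv.toName, reduceCtorEq, Name.par.injEq] at h
  all_goals
    obtain ⟨h, h'⟩ := h
    obtain rfl := Deriv.eq_of_toName _ h
    obtain rfl := Deriv.eq_of_toName _ h'
    simp_all [Lab.Comp]

theorem Tr.of_name_res {χ t : Tr E} {L : Set (C ⊕ S)} (h : χ.name = .res t.name L) :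
    χ.src = .res t.src L ∧ χ.lab = t.lab ∧ χ.tgt = .res t.tgt L := by
  obtain ⟨_, _, _, d⟩ := χ
  cases d <;> simp only [Tr.name, Deriv.toName, reduceCtorEq, Name.res.injEq] at h
  all_goals
    obtain ⟨h, rfl⟩ := h
    obtain rfl := Deriv.eq_of_toName _ h
    simp

theorem Tr.of_name_rel {χ t : Tr E} {f : Relabelling C B S} (h : χ.name = .rel t.name f) :
    χ.src = .rel t.src f ∧ χ.lab = f.lab t.lab ∧ χ.tgt = .rel t.tgt f := by
  obtain ⟨_, _, _, d⟩ := χ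
  cases d <;> simp only [Tr.name, Deriv.toName, reduceCtorEq, Name.rel.injEq] at h
  all_goals
    obtain ⟨h, rfl⟩ := h
    obtain rfl := Deriv.eq_of_toName _ h
    simp

/-- Discards and signal emissions lead back to the identifier itself, so the target is that of `t`
only for actions. -/
theorem Tr.of_name_agent {χ t : Tr E} {X : A} (h : χ.name = .agent X t.name) :
    χ.src = .agent X ∧ t.src = E.body X ∧ χ.lab = t.lab ∧ (t.lab.IsAct → χ.tgt = t.tgt) := by
  obtain ⟨_, _, _, d⟩ := χ
  cases d <;> simp only [Tr.name, Deriv.toName, reduceCtorEq, Name.agent.injEq] at h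
  all_goals
    obtain ⟨rfl, h⟩ := h
    obtain rfl := Deriv.eq_of_toName _ h
    simp [Lab.IsAct]

theorem Tr.of_name_signal {χ t : Tr E} {r : S} (h : χ.name = .signal t.name r) :
    χ.src = .signal t.src r ∧ χ.lab = t.lab ∧ (t.lab.IsAct → χ.tgt = t.tgt) := by
  obtain ⟨_, _, _, d⟩ := χ
  cases d <;> simp only [Tr.name, Deriv.toName, reduceCtorEq, Name.signal.injEq] at h
  all_goals
    obtain ⟨h, rfl⟩ := h
    obtain rfl := Deriv.eq_of_toName _ h
    simp [Lab.IsAct]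

theorem Tr.of_src_nil {χ : Tr E} (h : χ.src = .nil) : ∃ b, χ.name = .disNil b := by
  obtain ⟨_, _, _, d⟩ := χ
  cases d <;> cases h
  exact ⟨_, rfl⟩

theorem Tr.of_src_pre {χ : Tr E} {α : Act C B S} {P : Proc A C B S} (h : χ.src = .pre α P) :
    χ.name = .act α P ∨ ∃ b, χ.name = .disAct b α P := by
  obtain ⟨_, _, _, d⟩ := χ
  cases d <;> cases h
  · exact .inl rfl
  · exact .inr ⟨_, rfl⟩

theorem Tr.of_src_sum {χ : Tr E} {P Q : Proc A C B S} (h : χ.src = .sum P Q) :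
    (∃ t : Tr E, t.src = P ∧ χ.name = .sumL t.name Q) ∨
    (∃ u : Tr E, u.src = Q ∧ χ.name = .sumR P u.name) ∨
    ∃ t u : Tr E, t.src = P ∧ u.src = Q ∧ χ.name = .sum t.name u.name := by
  obtain ⟨_, _, _, d⟩ := χ
  cases d with
  | sumL t | sigSumL t => cases h; exact .inl ⟨⟨_, _, _, t⟩, rfl, rfl⟩
  | sumR _ u | sigSumR _ u => cases h; exact .inr (.inl ⟨⟨_, _, _, u⟩, rfl, rfl⟩)
  | disSum t u => cases h; exact .inr (.inr ⟨⟨_, _, _, t⟩, ⟨_, _, _, u⟩, rfl, rfl, rfl⟩)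
  | _ => cases h

theorem Tr.of_src_par {χ : Tr E} {P Q : Proc A C B S} (h : χ.src = .par P Q) :
    (∃ t : Tr E, t.src = P ∧ χ.name = .parL t.name Q) ∨
    (∃ u : Tr E, u.src = Q ∧ χ.name = .parR P u.name) ∨
    ∃ t u : Tr E, t.src = P ∧ u.src = Q ∧ χ.name = .par t.name u.name := by
  obtain ⟨_, _, _, d⟩ := χ
  cases d with
  | parL t => cases h; exact .inl ⟨⟨_, _, _, t⟩, rfl, rfl⟩
  | parR _ u => cases h; exact .inr (.inl ⟨⟨_, _, _, u⟩, rfl, rfl⟩)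
  | comm t u | bro t u => cases h; exact .inr (.inr ⟨⟨_, _, _, t⟩, ⟨_, _, _, u⟩, rfl, rfl, rfl⟩)
  | _ => cases h

theorem Tr.of_src_res {χ : Tr E} {P : Proc A C B S} {L : Set (C ⊕ S)} (h : χ.src = .res P L) :
    ∃ t : Tr E, t.src = P ∧ χ.name = .res t.name L := by
  obtain ⟨_, _, _, d⟩ := χ
  cases d with
  | res t => cases h; exact ⟨⟨_, _, _, t⟩, rfl, rfl⟩
  | _ => cases h

theorem Tr.of_src_rel {χ : Tr E} {P : Proc A C B S} {f : Relabelling C B S}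
    (h : χ.src = .rel P f) : ∃ t : Tr E, t.src = P ∧ χ.name = .rel t.name f := by
  obtain ⟨_, _, _, d⟩ := χ
  cases d with
  | rel t => cases h; exact ⟨⟨_, _, _, t⟩, rfl, rfl⟩
  | _ => cases h

theorem Tr.of_src_agent {χ : Tr E} {X : A} (h : χ.src = .agent X) :
    ∃ t : Tr E, t.src = E.body X ∧ χ.name = .agent X t.name := by
  obtain ⟨_, _, _, d⟩ := χ
  cases d with
  | unfold _ t | disRec _ t | sigRec _ t => cases h; exact ⟨⟨_, _, _, t⟩, rfl, rfl⟩
  | _ => cases h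

theorem Tr.of_src_signal {χ : Tr E} {P : Proc A C B S} {r : S} (h : χ.src = .signal P r) :
    χ.name = .sig P r ∨ ∃ t : Tr E, t.src = P ∧ χ.name = .signal t.name r := by
  obtain ⟨_, _, _, d⟩ := χ
  cases d with
  | sig => cases h; exact .inl rfl
  | sigSig t | actSig t | disSig t => cases h; exact .inr ⟨⟨_, _, _, t⟩, rfl, rfl⟩
  | _ => cases h

/-- Induction over transitions, by cases on the outermost constructor of their names. -/
theorem Tr.name_induction {motive : Tr E → Prop}
    (act : ∀ χ α P, χ.name = .act α P → motive χ)
    (disNil : ∀ χ b, χ.name = .disNil b → motive χ)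
    (disAct : ∀ χ b α P, χ.name = .disAct b α P → motive χ)
    (sumL : ∀ (χ t : Tr E) Q, χ.name = .sumL t.name Q → motive t → motive χ)
    (sumR : ∀ (χ u : Tr E) P, χ.name = .sumR P u.name → motive u → motive χ)
    (sum : ∀ χ t u : Tr E, χ.name = .sum t.name u.name → motive t → motive u → motive χ)
    (parL : ∀ (χ t : Tr E) Q, χ.name = .parL t.name Q → motive t → motive χ)
    (parR : ∀ (χ u : Tr E) P, χ.name = .parR P u.name → motive u → motive χ)
    (par : ∀ χ t u : Tr E, χ.name = .par t.name u.name → motive t → motive u → motive χ)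
    (res : ∀ (χ t : Tr E) L, χ.name = .res t.name L → motive t → motive χ)
    (rel : ∀ (χ t : Tr E) f, χ.name = .rel t.name f → motive t → motive χ)
    (agent : ∀ (χ t : Tr E) X, χ.name = .agent X t.name → motive t → motive χ)
    (sig : ∀ χ P s, χ.name = .sig P s → motive χ)
    (signal : ∀ (χ t : Tr E) r, χ.name = .signal t.name r → motive t → motive χ)
    (χ : Tr E) : motive χ := by
  obtain ⟨P, ℓ, Q, d⟩ := χ
  induction d with
  | act => exact act _ _ _ rfl
  | disNil => exact disNil _ _ rfl
  | disAct => exact disAct _ _ _ _ rfl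
  | sumL t _ ih | sigSumL t _ ih => exact sumL _ ⟨_, _, _, t⟩ _ rfl ih
  | sumR _ t ih | sigSumR _ t ih => exact sumR _ ⟨_, _, _, t⟩ _ rfl ih
  | disSum t u iht ihu => exact sum _ ⟨_, _, _, t⟩ ⟨_, _, _, u⟩ rfl iht ihu
  | parL t _ _ ih => exact parL _ ⟨_, _, _, t⟩ _ rfl ih
  | parR _ t _ ih => exact parR _ ⟨_, _, _, t⟩ _ rfl ih
  | comm t u _ iht ihu | bro t u _ iht ihu =>
    exact par _ ⟨_, _, _, t⟩ ⟨_, _, _, u⟩ rfl iht ihu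
  | res t _ _ ih => exact res _ ⟨_, _, _, t⟩ _ rfl ih
  | rel t _ ih => exact rel _ ⟨_, _, _, t⟩ _ rfl ih
  | unfold _ t ih | disRec _ t ih | sigRec _ t ih => exact agent _ ⟨_, _, _, t⟩ _ rfl ih
  | sig => exact sig _ _ _ rfl
  | sigSig t _ ih | actSig t _ ih | disSig t _ ih => exact signal _ ⟨_, _, _, t⟩ _ rfl ih

/-- A transition whose label is not an action does not change the state. -/
theorem Tr.tgt_eq_src {χ : Tr E} (h : ¬ χ.lab.IsAct) : χ.tgt = χ.src := by
  obtain ⟨P, ℓ, Q, d⟩ := χ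
  change ¬ ℓ.IsAct at h
  change Q = P
  induction d with
  | act | sumL | sumR | comm | unfold | actSig => exact absurd trivial h
  | disNil | disAct | disRec | sig | sigRec => rfl
  | parL _ _ _ ih | parR _ _ _ ih | res _ _ _ ih | sigSumL _ _ ih | sigSumR _ _ ih
  | sigSig _ _ ih | disSig _ _ ih => rw [ih h]
  | rel t f ih => rw [ih (by rwa [Relabelling.lab_isAct] at h)]
  | disSum t u iht ihu => rw [iht h, ihu h]
  | bro t u hb iht ihu =>
    cases hb with
    | disc_disc => rw [iht h, ihu h]
    | _ => exact absurd trivial h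


/-! ### Labels of synchrons -/

/-- The label of the transition executed at a leaf. -/
def Leaf.lab : Leaf A C B S → Lab C B S
  | .act α _ => .act α
  | .disc b => .disc b
  | .sig _ s => .emit s

/-- The effect of an argument on labels. -/
def Arg.onLab : Arg A C B S → Lab C B S → Lab C B S
  | .rel f, ℓ => f.lab ℓ
  | _, ℓ => ℓ

/-- The label that a synchron contributes: the relabelled label of its leaf. -/
def Synchron.lab (ς : Synchron A C B S) : Lab C B S := ς.args.foldr Arg.onLab ς.leaf.lab

theorem Synchron.lab_cons (ι : Arg A C B S) (ς : Synchron A C B S) :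
    (ς.cons ι).lab = ι.onLab ς.lab := rfl

/-- Only relabelling arguments act on labels, and these are static. -/
theorem foldr_onLab_static (σ : List (Arg A C B S)) (ℓ : Lab C B S) :
    (static σ).foldr Arg.onLab ℓ = σ.foldr Arg.onLab ℓ := by
  induction σ with
  | nil => rfl
  | cons ι σ ih =>
    unfold static at ih
    cases ι <;> simp [static, List.filter_cons, Arg.isStatic, Arg.onLab, ih]

theorem common_append_drop {α : Type*} (σ τ : List α) :
    common σ τ ++ σ.drop (common σ τ).length = σ := by
  induction σ generalizing τ with
  | nil => simp [common]
  | cons a σ ih =>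
    cases τ with
    | nil => simp [common]
    | cons b τ =>
      simp only [common]
      split_ifs
      · simpa using ih τ
      · simp

/-- This invariance is what lets labels of synchrons be compared before and after a transition. -/
theorem Synchron.lab_after (ς υ : Synchron A C B S) : (ς.after υ).lab = ς.lab := by
  unfold Synchron.lab Synchron.after
  simp only [List.foldr_append, foldr_onLab_static]
  rw [← List.foldr_append, common_append_drop]

theorem Synchron.lab_afterTr (ς : Synchron A C B S) (w : Tr E) : (ς.afterTr w).lab = ς.lab := by
  unfold Synchron.afterTr
  split_ifs
  · exact ς.lab_after _
  · rfl

theorem Arg.isRecvOrDisc_onLab (ι : Arg A C B S) (ℓ : Lab C B S) :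
    (∃ b, (ι.onLab ℓ).IsRecvOrDisc b) ↔ ∃ b, ℓ.IsRecvOrDisc b := by
  cases ι <;> rcases ℓ with (_ | _ | _ | _ | _ | _) | _ | _ <;>
    simp [Arg.onLab, Relabelling.lab, Lab.IsRecvOrDisc]

theorem Arg.isAct_onLab (ι : Arg A C B S) (ℓ : Lab C B S) : (ι.onLab ℓ).IsAct ↔ ℓ.IsAct := by
  cases ι <;> simp [Arg.onLab, Relabelling.lab_isAct]

/-- Necessity is defined at the leaf, but relabelling preserves the kind of a label, so it can be
read off at the root. -/
theorem Synchron.necessary_iff (ς : Synchron A C B S) :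
    ς.Necessary ↔ ¬ ∃ b, ς.lab.IsRecvOrDisc b := by
  obtain ⟨σ, l⟩ := ς
  induction σ with
  | nil =>
    rcases l with ((_ | _ | _ | _ | _ | _) | _ | _) <;>
      simp [Synchron.Necessary, Synchron.lab, Leaf.lab, Lab.IsRecvOrDisc]
  | cons ι σ ih =>
    rw [show (⟨ι :: σ, l⟩ : Synchron A C B S) = Synchron.cons ι ⟨σ, l⟩ from rfl,
      Synchron.lab_cons, Arg.isRecvOrDisc_onLab, ← ih]
    rfl

theorem Synchron.active_iff (ς : Synchron A C B S) : ς.Active ↔ ς.lab.IsAct := by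
  obtain ⟨σ, l⟩ := ς
  induction σ with
  | nil => cases l <;> simp [Synchron.Active, Synchron.lab, Leaf.lab, Lab.IsAct]
  | cons ι σ ih =>
    rw [show (⟨ι :: σ, l⟩ : Synchron A C B S) = Synchron.cons ι ⟨σ, l⟩ from rfl,
      Synchron.lab_cons, Arg.isAct_onLab, ← ih]
    rfl

theorem Synchron.necessary_cons (ι : Arg A C B S) (ς : Synchron A C B S) :
    (ς.cons ι).Necessary ↔ ς.Necessary := Iff.rfl

/-- The constraints that the label of a transition imposes on the set `M` of labels of its
synchrons. -/
def LabSpec (M : Set (Lab C B S)) : Lab C B S → Prop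
  | .act .tau => .act .tau ∈ M ∨ ∃ c ∈ M, ∃ c' ∈ M, Lab.Compl c c'
  | .act (.bang b) => .act (.bang b) ∈ M
  | .act (.recv b) => ∀ m ∈ M, m.IsRecvOrDisc b
  | ℓ => ∀ m ∈ M, m = ℓ

theorem LabSpec.singleton (ℓ : Lab C B S) : LabSpec {ℓ} ℓ := by
  rcases ℓ with (_ | _ | _ | _ | _ | _) | _ | _ <;> simp [LabSpec, Lab.IsRecvOrDisc]

theorem Relabelling.compl_lab (f : Relabelling C B S) {c c' : Lab C B S} (h : Lab.Compl c c') :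
    Lab.Compl (f.lab c) (f.lab c') := by
  cases h <;> constructor

theorem LabSpec.relabel {M : Set (Lab C B S)} {ℓ : Lab C B S} (h : LabSpec M ℓ)
    (f : Relabelling C B S) : LabSpec (f.lab '' M) (f.lab ℓ) := by
  rcases ℓ with (_ | _ | _ | b | b | _) | _ | _
  case act.tau =>
    rcases h with h | ⟨c, hc, c', hc', h⟩
    · exact .inl ⟨_, h, rfl⟩
    · exact .inr ⟨_, ⟨c, hc, rfl⟩, _, ⟨c', hc', rfl⟩, f.compl_lab h⟩
  case act.bang => exact ⟨_, h, rfl⟩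
  case act.recv =>
    rintro _ ⟨m, hm, rfl⟩
    rcases h m hm with rfl | rfl
    · exact .inl rfl
    · exact .inr rfl
  all_goals
    rintro _ ⟨m, hm, rfl⟩
    exact congrArg _ (h m hm)

/-- A label that can take part in a handshake falls under the default clause of `LabSpec`, where all
synchrons share one label. -/
theorem Lab.Compl.labSpec_left {M : Set (Lab C B S)} {c c' : Lab C B S} (h : Lab.Compl c c')
    (hM : LabSpec M c) : ∀ m ∈ M, m = c := by
  cases h <;> exact hM

theorem Lab.Compl.symm {c c' : Lab C B S} (h : Lab.Compl c c') : Lab.Compl c' c := by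
  cases h <;> constructor

theorem Lab.Compl.labSpec_right {M : Set (Lab C B S)} {c c' : Lab C B S} (h : Lab.Compl c c')
    (hM : LabSpec M c') : ∀ m ∈ M, m = c' :=
  h.symm.labSpec_left hM

/-- Nonemptiness supplies the two complementary labels that witness a handshake; the default clause
alone could hold vacuously. -/
theorem LabSpec.comp {M₁ M₂ : Set (Lab C B S)} {ℓ₁ ℓ₂ ℓ : Lab C B S} (h₁ : LabSpec M₁ ℓ₁)
    (h₂ : LabSpec M₂ ℓ₂) (hM₁ : M₁.Nonempty) (hM₂ : M₂.Nonempty) (h : Lab.Comp ℓ₁ ℓ₂ ℓ) :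
    LabSpec (M₁ ∪ M₂) ℓ := by
  rcases h with ⟨h, rfl⟩ | h
  · obtain ⟨m₁, hm₁⟩ := hM₁
    obtain ⟨m₂, hm₂⟩ := hM₂
    obtain rfl := h.labSpec_left h₁ m₁ hm₁
    obtain rfl := h.labSpec_right h₂ m₂ hm₂
    exact .inr ⟨_, .inl hm₁, _, .inr hm₂, h⟩
  · cases h with
    | bang_recv | bang_disc => exact .inl h₁
    | recv_bang | disc_bang => exact .inr h₂
    | recv_recv => exact fun m hm => hm.elim (h₁ m) (h₂ m)
    | recv_disc => exact fun m hm => hm.elim (h₁ m) fun hm => .inr (h₂ m hm)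
    | disc_recv => exact fun m hm => hm.elim (fun hm => .inr (h₁ m hm)) (h₂ m)
    | disc_disc => exact fun m hm => hm.elim (h₁ m) (h₂ m)

theorem Tr.synchrons_nonempty (t : Tr E) : t.synchrons.Nonempty := by
  unfold Tr.synchrons
  induction t.name with
  | act | disNil | disAct | sig => exact Set.singleton_nonempty _
  | sumL _ _ ih | sumR _ _ ih | parL _ _ ih | parR _ _ ih | res _ _ ih | rel _ _ ih
  | agent _ _ ih | signal _ _ ih => exact ih.image _
  | sum _ _ ih | par _ _ ih => exact (ih.image _).inl

/-- The set of labels of the synchrons of a transition. -/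
def Tr.labs (t : Tr E) : Set (Lab C B S) := Synchron.lab '' t.synchrons

theorem Tr.labs_nonempty (t : Tr E) : t.labs.Nonempty := t.synchrons_nonempty.image _

theorem image_lab_cons (ι : Arg A C B S) (X : Set (Synchron A C B S)) :
    Synchron.lab '' (Synchron.cons ι '' X) = ι.onLab '' (Synchron.lab '' X) := by
  simp only [Set.image_image]
  rfl

theorem image_onLab {ι : Arg A C B S} (h : ∀ ℓ, ι.onLab ℓ = ℓ) (M : Set (Lab C B S)) :
    ι.onLab '' M = M := by
  simp [h]

theorem Tr.labSpec (t : Tr E) : LabSpec t.labs t.lab := by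
  unfold Tr.labs Tr.synchrons
  induction t using Tr.name_induction with
  | act χ α P h =>
    rw [h, (Tr.of_name_act h).2.1, Name.synchrons, Set.image_singleton]
    exact .singleton _
  | disNil χ b h =>
    rw [h, (Tr.of_name_disNil h).2, Name.synchrons, Set.image_singleton]
    exact .singleton _
  | disAct χ b α P h =>
    rw [h, (Tr.of_name_disAct h).2, Name.synchrons, Set.image_singleton]
    exact .singleton _
  | sig χ P s h =>
    rw [h, (Tr.of_name_sig h).2, Name.synchrons, Set.image_singleton]
    exact .singleton _
  | sumL χ t Q h ih =>
    rw [h, (Tr.of_name_sumL h).2.1, Name.synchrons, image_lab_cons, image_onLab fun _ => rfl]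
    exact ih
  | sumR χ t Q h ih =>
    rw [h, (Tr.of_name_sumR h).2.1, Name.synchrons, image_lab_cons, image_onLab fun _ => rfl]
    exact ih
  | sum χ t u h iht ihu =>
    obtain ⟨-, b, h₁, h₂, h₃⟩ := Tr.of_name_sum h
    rw [h, h₁, Name.synchrons, Set.image_union, image_lab_cons, image_lab_cons,
      image_onLab fun _ => rfl, image_onLab fun _ => rfl]
    rw [h₂] at iht
    rw [h₃] at ihu
    exact iht.comp ihu t.labs_nonempty u.labs_nonempty (.inr (.disc_disc b))
  | parL χ t Q h ih =>
    rw [h, (Tr.of_name_parL h).2.1, Name.synchrons, image_lab_cons, image_onLab fun _ => rfl]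
    exact ih
  | parR χ t Q h ih =>
    rw [h, (Tr.of_name_parR h).2.1, Name.synchrons, image_lab_cons, image_onLab fun _ => rfl]
    exact ih
  | par χ t u h iht ihu =>
    rw [h, Name.synchrons, Set.image_union, image_lab_cons, image_lab_cons,
      image_onLab fun _ => rfl, image_onLab fun _ => rfl]
    exact iht.comp ihu t.labs_nonempty u.labs_nonempty (Tr.of_name_par h).2.1
  | res χ t L h ih =>
    rw [h, (Tr.of_name_res h).2.1, Name.synchrons, image_lab_cons, image_onLab fun _ => rfl]
    exact ih
  | rel χ t f h ih =>
    rw [h, (Tr.of_name_rel h).2.1, Name.synchrons, image_lab_cons]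
    exact ih.relabel f
  | agent χ t X h ih =>
    rw [h, (Tr.of_name_agent h).2.2.1, Name.synchrons, image_lab_cons, image_onLab fun _ => rfl]
    exact ih
  | signal χ t r h ih =>
    rw [h, (Tr.of_name_signal h).2.1, Name.synchrons, image_lab_cons, image_onLab fun _ => rfl]
    exact ih

/-- All synchrons of a discard or emission carry the label of the whole, which is not an action. -/
theorem Tr.activeSynchrons_eq_empty {t : Tr E} (h : ¬ t.lab.IsAct) : t.activeSynchrons = ∅ := by
  ext ς
  simp only [Tr.activeSynchrons, Set.mem_ofPred_eq, Set.mem_empty_iff_false, iff_false, not_and,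
    Synchron.active_iff]
  intro hς
  have hs := t.labSpec
  have hm : ς.lab ∈ t.labs := ⟨ς, hς, rfl⟩
  revert hs h
  rcases t.lab with _ | b | s
  · exact fun h => absurd trivial h
  · intro h hs
    rwa [hs _ hm]
  · intro h hs
    rwa [hs _ hm]

/-- A transition has no necessary synchrons iff it receives or discards a broadcast. -/
theorem Tr.forall_not_necessary_iff (t : Tr E) :
    (∀ ς ∈ t.synchrons, ¬ ς.Necessary) ↔ ∃ b, t.lab.IsRecvOrDisc b := by
  have hs := t.labSpec
  have key : (∀ ς ∈ t.synchrons, ¬ ς.Necessary) ↔ ∀ m ∈ t.labs, ∃ b, m.IsRecvOrDisc b := by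
    simp [Tr.labs, Synchron.necessary_iff]
  rw [key]
  obtain ⟨m, hm⟩ := t.labs_nonempty
  revert hs
  rcases t.lab with (c | c | _ | b | b | s) | b | s <;> intro hs
  case act.tau =>
    simp only [Lab.IsRecvOrDisc, reduceCtorEq, Lab.act.injEq, or_self, exists_false, iff_false]
    intro h
    -- An internal action stems from a `τ`-prefix or from a handshake; either way some synchron has
    -- a non-broadcast label.
    rcases hs with hs | ⟨c, hc, c', hc', hs⟩
    · simpa using h _ hs
    · obtain ⟨b, h⟩ := h _ hc
      cases hs <;> simp at h
  case act.bang =>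
    simp only [Lab.IsRecvOrDisc, reduceCtorEq, Lab.act.injEq, or_self, exists_false, iff_false]
    intro h
    simpa using h _ hs
  case act.recv => exact iff_of_true (fun m hm => ⟨b, hs m hm⟩) ⟨b, .inl rfl⟩
  case disc => exact iff_of_true (fun m hm => ⟨b, .inr (hs m hm)⟩) ⟨b, .inr rfl⟩
  all_goals
    simp only [Lab.IsRecvOrDisc, reduceCtorEq, Lab.act.injEq, or_self, exists_false, iff_false]
    intro h
    simpa [hs m hm] using h m hm

/-! ### Compatible labels -/

/-- The labels are equal, or they are `b?` and `b:` in some order. -/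
def Lab.Compat (ℓ ℓ' : Lab C B S) : Prop :=
  ℓ = ℓ' ∨ ∃ b : B, ℓ.IsRecvOrDisc b ∧ ℓ'.IsRecvOrDisc b

theorem Lab.compat_iff (ℓ ℓ' : Lab C B S) :
    (ℓ = ℓ' ∨ ∃ b : B, ({ℓ, ℓ'} : Set (Lab C B S)) = {.act (.recv b), .disc b}) ↔
      ℓ.Compat ℓ' := by
  simp only [Lab.Compat, Lab.IsRecvOrDisc, Set.pair_eq_pair_iff]
  constructor
  · rintro (h | ⟨b, ⟨rfl, rfl⟩ | ⟨rfl, rfl⟩⟩)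
    · exact .inl h
    · exact .inr ⟨b, .inl rfl, .inr rfl⟩
    · exact .inr ⟨b, .inr rfl, .inl rfl⟩
  · rintro (h | ⟨b, rfl | rfl, rfl | rfl⟩)
    · exact .inl h
    · exact .inl rfl
    · exact .inr ⟨b, .inl ⟨rfl, rfl⟩⟩
    · exact .inr ⟨b, .inr ⟨rfl, rfl⟩⟩
    · exact .inl rfl

theorem Lab.Compat.refl (ℓ : Lab C B S) : ℓ.Compat ℓ := .inl rfl

theorem Lab.Compat.symm {ℓ ℓ' : Lab C B S} (h : ℓ.Compat ℓ') : ℓ'.Compat ℓ :=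
  h.imp Eq.symm fun ⟨b, h₁, h₂⟩ => ⟨b, h₂, h₁⟩

theorem Lab.Compat.isRecvOrDisc {ℓ ℓ' : Lab C B S} (h : ℓ.Compat ℓ') {b : B}
    (hb : ℓ.IsRecvOrDisc b) : ℓ'.IsRecvOrDisc b := by
  rcases h with rfl | ⟨b', h, h'⟩
  · exact hb
  · rcases hb with rfl | rfl <;> simp [Lab.IsRecvOrDisc] at h <;> subst h <;> exact h'

theorem Lab.Compat.eq {ℓ ℓ' : Lab C B S} (h : ℓ.Compat ℓ') (hb : ¬ ∃ b, ℓ.IsRecvOrDisc b) :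
    ℓ = ℓ' := by
  rcases h with rfl | ⟨b', h, h'⟩
  · rfl
  · exact absurd ⟨b', h⟩ hb

theorem Lab.IsEta.not_isRecvOrDisc {ℓ : Lab C B S} (h : ℓ.IsEta) : ¬ ∃ b, ℓ.IsRecvOrDisc b := by
  rintro ⟨b, rfl | rfl⟩ <;> exact h

theorem Lab.Compat.relabel {ℓ ℓ' : Lab C B S} (h : ℓ.Compat ℓ') (f : Relabelling C B S) :
    (f.lab ℓ).Compat (f.lab ℓ') := by
  rcases h with rfl | ⟨b, rfl | rfl, rfl | rfl⟩
  · exact .refl _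
  all_goals exact .inr ⟨f.onB b, by simp [Relabelling.lab, Lab.IsRecvOrDisc]⟩

/-- Exchanging `?` and `:` in components is invisible next to a `!`, and otherwise can only exchange
`?` and `:` in the composition. -/
theorem Lab.Compat.comp {ℓ₁ ℓ₂ ℓ ℓ₁' ℓ₂' ℓ' : Lab C B S} (h₁ : ℓ₁.Compat ℓ₁')
    (h₂ : ℓ₂.Compat ℓ₂') (h : Lab.Comp ℓ₁ ℓ₂ ℓ) (h' : Lab.Comp ℓ₁' ℓ₂' ℓ') : ℓ.Compat ℓ' := by
  have bro : Lab.Bro ℓ₁ ℓ₂ ℓ → Lab.Bro ℓ₁' ℓ₂' ℓ' → ℓ.Compat ℓ' := by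
    intro h h'
    cases h <;> cases h' <;> simp_all [Lab.Compat, Lab.IsRecvOrDisc]
  rcases h with ⟨h, rfl⟩ | h <;> rcases h' with ⟨h', rfl⟩ | h'
  · exact .refl _
  · cases h <;> cases h' <;> simp_all [Lab.Compat, Lab.IsRecvOrDisc]
  · cases h <;> cases h' <;> simp_all [Lab.Compat, Lab.IsRecvOrDisc]
  · exact bro h h'

/-- Labels other than those of received and discarded broadcasts carry over. -/
def LabCarry (M M' : Set (Lab C B S)) : Prop := ∀ m ∈ M, (¬ ∃ b, m.IsRecvOrDisc b) → m ∈ M'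

theorem Lab.Compl.not_isRecvOrDisc {c c' : Lab C B S} (h : Lab.Compl c c') :
    ¬ ∃ b, c.IsRecvOrDisc b := by
  rintro ⟨b, rfl | rfl⟩ <;> cases h

theorem LabCarry.eq_of_compl {M M' : Set (Lab C B S)} {c c' d d' : Lab C B S}
    (h : LabCarry M M') (hM : M.Nonempty) (hc : Lab.Compl c c') (hd : Lab.Compl d d')
    (hMc : LabSpec M c) (hMd : LabSpec M' d) : c = d := by
  obtain ⟨m, hm⟩ := hM
  obtain rfl := hc.labSpec_left hMc m hm
  exact hd.labSpec_left hMd _ (h _ hm hc.not_isRecvOrDisc)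

/-- A handshake partner has synchrons of a single label `d`, whereas a `τ`-transition carries over
either a `τ` or two distinct complementary labels. -/
theorem LabCarry.not_compl_of_tau {M M' : Set (Lab C B S)} {d d' : Lab C B S}
    (h : LabCarry M M') (hM : LabSpec M (.act .tau)) (hM' : LabSpec M' d) :
    ¬ Lab.Compl d d' := by
  intro hd
  have hall := hd.labSpec_left hM'
  rcases hM with hM | ⟨c, hc, c', hc', hcc⟩
  · have := hall _ (h _ hM (by simp [Lab.IsRecvOrDisc]))
    subst this
    cases hd
  · have h₁ := hall _ (h _ hc hcc.not_isRecvOrDisc)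
    have h₂ := hall _ (h _ hc' hcc.symm.not_isRecvOrDisc)
    subst h₁ h₂
    cases hcc

/-- The sending synchron is necessary, so it persists, and no receive or discard contains one. -/
theorem LabCarry.not_isRecvOrDisc_of_bang {M M' : Set (Lab C B S)} {ℓ' : Lab C B S} {b : B}
    (h : LabCarry M M') (hM : LabSpec M (.act (.bang b))) (hM' : LabSpec M' ℓ') (b' : B) :
    ¬ ℓ'.IsRecvOrDisc b' := by
  have hb := h _ hM (by simp [Lab.IsRecvOrDisc])
  rintro (rfl | rfl)
  · simpa [Lab.IsRecvOrDisc] using hM' _ hb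
  · simpa using hM' _ hb

/-- Relabelling may identify handshake names or signals, but there the carried synchrons determine
the name. For receives and discards nothing need be carried, and injectivity must recover the
broadcast name. -/
theorem LabCarry.compat_of_relabel {M M' : Set (Lab C B S)} {ℓ ℓ' : Lab C B S}
    (h : LabCarry M M') (hne : M.Nonempty) (hM : LabSpec M ℓ) (hM' : LabSpec M' ℓ')
    {f : Relabelling C B S} (hf : Function.Injective f.onB)
    (hl : (f.lab ℓ).Compat (f.lab ℓ')) : ℓ.Compat ℓ' := by
  rcases ℓ with (_ | _ | _ | _ | _ | _) | _ | _ <;>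
    rcases ℓ' with (_ | _ | _ | _ | _ | _) | _ | _ <;>
    simp [Relabelling.lab, Lab.Compat, Lab.IsRecvOrDisc, hf.eq_iff] at hl ⊢
  all_goals first
    | exact hl
    | skip
  -- Broadcasts are settled; what remains are names and signals that `f` might identify.
  · simpa using h.eq_of_compl hne (.name _) (.name _) hM hM'
  · simpa using h.eq_of_compl hne (.coname _) (.coname _) hM hM'
  · simpa using h.eq_of_compl hne (.read _) (.read _) hM hM'
  · simpa using h.eq_of_compl hne (.emit _) (.emit _) hM hM'

/-- The composite label hides the handshake channel and which side sends a broadcast; the carried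
synchrons reveal both. -/
theorem LabCarry.compat_of_comp {M₁ M₂ M₁' M₂' : Set (Lab C B S)}
    {ℓ₁ ℓ₂ ℓ ℓ₁' ℓ₂' ℓ' : Lab C B S} (h₁ : LabCarry M₁ M₁') (h₂ : LabCarry M₂ M₂')
    (hne₁ : M₁.Nonempty) (hne₂ : M₂.Nonempty) (hM₁ : LabSpec M₁ ℓ₁) (hM₂ : LabSpec M₂ ℓ₂)
    (hM₁' : LabSpec M₁' ℓ₁') (hM₂' : LabSpec M₂' ℓ₂') (h : Lab.Comp ℓ₁ ℓ₂ ℓ)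
    (h' : Lab.Comp ℓ₁' ℓ₂' ℓ') (hl : ℓ.Compat ℓ') : ℓ₁.Compat ℓ₁' ∧ ℓ₂.Compat ℓ₂' := by
  rcases h with ⟨h, rfl⟩ | h <;> rcases h' with ⟨h', rfl⟩ | h'
  · exact ⟨.inl (h₁.eq_of_compl hne₁ h h' hM₁ hM₁'),
      .inl (h₂.eq_of_compl hne₂ h.symm h'.symm hM₂ hM₂')⟩
  · cases h' <;> simp [Lab.Compat, Lab.IsRecvOrDisc] at hl
  · cases h <;> simp [Lab.Compat, Lab.IsRecvOrDisc] at hl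
  · cases h <;> cases h' <;> simp [Lab.Compat, Lab.IsRecvOrDisc] at hl ⊢
    all_goals first
      | exact hl
      | exact ⟨hl, hl⟩
      | (subst hl; simp)
      | (rcases hl with rfl | rfl <;> simp)
      -- The remaining cases would move the sender `!` to the other component.
      | exact absurd (.inl rfl) (h₁.not_isRecvOrDisc_of_bang hM₁ hM₁' _)
      | exact absurd (.inr rfl) (h₁.not_isRecvOrDisc_of_bang hM₁ hM₁' _)
      | exact absurd (.inl rfl) (h₂.not_isRecvOrDisc_of_bang hM₂ hM₂' _)
      | exact absurd (.inr rfl) (h₂.not_isRecvOrDisc_of_bang hM₂ hM₂' _)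


/-! ### Concurrency and the after-function on extended synchrons -/

/-- The synchron `υ` starts at the other side of the parallel composition that `ι` enters. -/
def OtherSide (ι : Arg A C B S) (υ : Synchron A C B S) : Prop :=
  ∃ D D' : Side, D ≠ D' ∧ ι = .par D ∧ ∃ υ', υ = Synchron.cons (.par D') υ'

theorem OtherSide.conc {ι : Arg A C B S} {υ : Synchron A C B S} (h : OtherSide ι υ)
    (ς : Synchron A C B S) : (ς.cons ι).Conc υ := by
  obtain ⟨D, D', hD, rfl, υ', rfl⟩ := h
  exact ⟨[], D, D', _, _, hD, rfl, rfl⟩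

theorem OtherSide.common_eq {ι : Arg A C B S} {υ : Synchron A C B S} (h : OtherSide ι υ)
    (ς : Synchron A C B S) : common (ς.cons ι).args υ.args = [] := by
  obtain ⟨D, D', hD, rfl, υ', rfl⟩ := h
  simp [common, Synchron.cons, hD]

theorem Synchron.conc_cons (ι : Arg A C B S) (ς υ : Synchron A C B S) :
    (ς.cons ι).Conc (υ.cons ι) ↔ ς.Conc υ := by
  constructor
  · rintro ⟨σ, D, D', σ₁, σ₂, hD, h₁, h₂⟩
    cases σ with
    -- Divergence cannot occur at the first argument, which is `ι` in both.
    | nil =>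
      simp only [Synchron.cons, List.nil_append, List.cons.injEq] at h₁ h₂
      have := h₁.1.symm.trans h₂.1
      simp_all
    | cons κ σ =>
      simp only [Synchron.cons, List.cons_append, List.cons.injEq] at h₁ h₂
      exact ⟨σ, D, D', σ₁, σ₂, hD, h₁.2, h₂.2⟩
  · rintro ⟨σ, D, D', σ₁, σ₂, hD, h₁, h₂⟩
    exact ⟨ι :: σ, D, D', σ₁, σ₂, hD, by simp [Synchron.cons, h₁], by simp [Synchron.cons, h₂]⟩

theorem common_cons_cons {α : Type*} (a : α) (σ τ : List α) :
    common (a :: σ) (a :: τ) = a :: common σ τ := by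
  simp [common]

theorem Synchron.after_cons_static {ι : Arg A C B S} (h : ι.isStatic = true)
    (ς υ : Synchron A C B S) : (ς.cons ι).after (υ.cons ι) = (ς.after υ).cons ι := by
  simp [Synchron.after, Synchron.cons, common_cons_cons, static, h]

theorem Synchron.after_cons_dynamic {ι : Arg A C B S} (h : ι.isStatic = false)
    (ς υ : Synchron A C B S) : (ς.cons ι).after (υ.cons ι) = ς.after υ := by
  simp [Synchron.after, Synchron.cons, common_cons_cons, static, h]

theorem OtherSide.after_eq {ι : Arg A C B S} {υ : Synchron A C B S} (h : OtherSide ι υ)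
    (ς : Synchron A C B S) : (ς.cons ι).after υ = ς.cons ι := by
  simp [Synchron.after, h.common_eq, static]

/-- Both common parts are initial parts of `ς`, so equal length makes them equal. Hence `ς @ w` does
not depend on which closest synchron is chosen. -/
theorem Synchron.after_congr {ς υ υ' : Synchron A C B S}
    (h : (common ς.args υ.args).length = (common ς.args υ'.args).length) :
    ς.after υ = ς.after υ' := by
  have h₁ := common_append_drop ς.args υ.args
  have h₂ := common_append_drop ς.args υ'.args
  have hc : common ς.args υ.args = common ς.args υ'.args :=
    (List.append_inj (h₁.trans h₂.symm) h).1
  simp [Synchron.after, hc]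

theorem Synchron.IsClosest.afterTr_eq {ς υ : Synchron A C B S} {w : Tr E}
    (h : ς.IsClosest w υ) (hw : w.lab.IsAct) : ς.afterTr w = ς.after υ := by
  have hex : w.lab.IsAct ∧ ∃ υ, ς.IsClosest w υ := ⟨hw, υ, h⟩
  rw [Synchron.afterTr, dif_pos hex]
  have hc := hex.2.choose_spec
  exact Synchron.after_congr (le_antisymm (h.2 _ hc.1) (hc.2 _ h.1))

theorem Synchron.afterTr_of_not_isAct {w : Tr E} (hw : ¬ w.lab.IsAct) (ς : Synchron A C B S) :
    ς.afterTr w = ς := by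
  rw [Synchron.afterTr, dif_neg fun h => hw h.1]

/-- The active synchrons of `ζ` that do not pass through the other side of the parallel
composition entered by `ι` are those of `v`, extended with `ι`. -/
structure Under (ι : Arg A C B S) (v ζ : Tr E) : Prop where
  isAct : v.lab.IsAct → ζ.lab.IsAct
  cons_mem : ∀ υ ∈ v.activeSynchrons, υ.cons ι ∈ ζ.activeSynchrons
  cases : ∀ υ ∈ ζ.activeSynchrons, (∃ υ' ∈ v.activeSynchrons, υ = υ'.cons ι) ∨ OtherSide ι υ

/-- All active synchrons of `ζ` pass through the other side of the parallel composition entered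
by `ι`. -/
def Beside (ι : Arg A C B S) (ζ : Tr E) : Prop := ∀ υ ∈ ζ.activeSynchrons, OtherSide ι υ

theorem Under.unaffected_iff {ι : Arg A C B S} {v ζ : Tr E} (h : Under ι v ζ)
    (ς : Synchron A C B S) : (ς.cons ι).Unaffected ζ ↔ ς.Unaffected v := by
  constructor
  · exact fun hς υ hυ => (Synchron.conc_cons ι ς υ).1 (hς _ (h.cons_mem υ hυ))
  · intro hς υ hυ
    rcases h.cases υ hυ with ⟨υ', hυ', rfl⟩ | ho
    · exact (Synchron.conc_cons ι ς υ').2 (hς _ hυ')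
    · exact ho.conc ς

theorem Beside.unaffected {ι : Arg A C B S} {ζ : Tr E} (h : Beside ι ζ)
    (ς : Synchron A C B S) : (ς.cons ι).Unaffected ζ :=
  fun υ hυ => (h υ hυ).conc ς

theorem Beside.afterTr_eq {ι : Arg A C B S} {ζ : Tr E} (h : Beside ι ζ)
    (ς : Synchron A C B S) : (ς.cons ι).afterTr ζ = ς.cons ι := by
  by_cases hζ : ζ.lab.IsAct
  · obtain ⟨υ, hυ⟩ := ζ.exists_isClosest hζ (ς.cons ι)
    rw [hυ.afterTr_eq hζ, (h υ hυ.1).after_eq]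
  · exact Synchron.afterTr_of_not_isAct hζ _

/-- Synchrons on the other side have an empty common part with `ς.cons ι`, so they never beat those
coming from `v`. -/
theorem Under.isClosest_cons {ι : Arg A C B S} {v ζ : Tr E} (h : Under ι v ζ)
    {ς υ : Synchron A C B S} (hυ : ς.IsClosest v υ) : (ς.cons ι).IsClosest ζ (υ.cons ι) := by
  refine ⟨h.cons_mem _ hυ.1, fun υ' hυ' => ?_⟩
  rcases h.cases υ' hυ' with ⟨υ'', hυ'', rfl⟩ | ho
  · simpa [Synchron.cons, common_cons_cons] using hυ.2 _ hυ''
  · simp [ho.common_eq]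

/-- A dynamic `ι` is deleted only if `v` performs an action; otherwise the after-function is the
identity and would keep it. -/
theorem Under.afterTr_dynamic {ι : Arg A C B S} {v ζ : Tr E} (h : Under ι v ζ)
    (hι : ι.isStatic = false) (hv : v.lab.IsAct) (ς : Synchron A C B S) :
    (ς.cons ι).afterTr ζ = ς.afterTr v := by
  obtain ⟨υ, hυ⟩ := v.exists_isClosest hv ς
  rw [hυ.afterTr_eq hv, (h.isClosest_cons hυ).afterTr_eq (h.isAct hv),
    Synchron.after_cons_dynamic hι]

theorem Under.afterTr_static {ι : Arg A C B S} {v ζ : Tr E} (h : Under ι v ζ)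
    (hι : ι.isStatic = true) (ς : Synchron A C B S) :
    (ς.cons ι).afterTr ζ = (ς.afterTr v).cons ι := by
  by_cases hv : v.lab.IsAct
  · obtain ⟨υ, hυ⟩ := v.exists_isClosest hv ς
    rw [hυ.afterTr_eq hv, (h.isClosest_cons hυ).afterTr_eq (h.isAct hv),
      Synchron.after_cons_static hι]
  · rw [Synchron.afterTr_of_not_isAct hv]
    -- Even if `v` does not act, `ζ` may, through the other component of a parallel composition;
    -- then all its active synchrons lie there.
    refine Beside.afterTr_eq (fun υ hυ => ?_) ς
    refine (h.cases υ hυ).resolve_left ?_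
    rintro ⟨υ', hυ', -⟩
    simp [Tr.activeSynchrons_eq_empty hv] at hυ'

/-! ### Active synchrons of composed transitions -/

theorem mem_activeSynchrons_image {ι : Arg A C B S} {v : Tr E} {υ : Synchron A C B S} :
    (υ ∈ Synchron.cons ι '' v.synchrons ∧ υ.Active) ↔
      ∃ υ' ∈ v.activeSynchrons, υ = υ'.cons ι := by
  constructor
  · rintro ⟨⟨υ', hυ', rfl⟩, ha⟩
    exact ⟨υ', ⟨hυ', ha⟩, rfl⟩
  · rintro ⟨υ', ⟨hυ', ha⟩, rfl⟩
    exact ⟨⟨υ', hυ', rfl⟩, ha⟩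

theorem Under.of_image {ι : Arg A C B S} {v ζ : Tr E}
    (h : ζ.synchrons = Synchron.cons ι '' v.synchrons) (hl : v.lab.IsAct → ζ.lab.IsAct) :
    Under ι v ζ := by
  have h' : ∀ υ, υ ∈ ζ.activeSynchrons ↔ ∃ υ' ∈ v.activeSynchrons, υ = υ'.cons ι := by
    intro υ
    rw [← mem_activeSynchrons_image, ← h]
    rfl
  exact ⟨hl, fun υ hυ => (h' _).2 ⟨υ, hυ, rfl⟩, fun υ hυ => .inl ((h' υ).1 hυ)⟩

theorem Under.of_union {D D' : Side} (hD : D ≠ D') {v w ζ : Tr E}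
    (h : ζ.synchrons =
      Synchron.cons (.par D) '' v.synchrons ∪ Synchron.cons (.par D') '' w.synchrons)
    (hl : v.lab.IsAct → ζ.lab.IsAct) : Under (.par D) v ζ := by
  have h' : ∀ υ, υ ∈ ζ.activeSynchrons ↔ (∃ υ' ∈ v.activeSynchrons, υ = υ'.cons (.par D)) ∨
      ∃ υ' ∈ w.activeSynchrons, υ = υ'.cons (.par D') := by
    intro υ
    rw [← mem_activeSynchrons_image, ← mem_activeSynchrons_image, ← or_and_right, ← Set.mem_union,
      ← h]
    rfl
  refine ⟨hl, fun υ hυ => (h' _).2 (.inl ⟨υ, hυ, rfl⟩), fun υ hυ => ?_⟩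
  exact ((h' υ).1 hυ).imp id fun ⟨υ', _, e⟩ => ⟨D, D', hD, rfl, υ', e⟩

theorem Beside.of_image {D D' : Side} (hD : D ≠ D') {w ζ : Tr E}
    (h : ζ.synchrons = Synchron.cons (.par D') '' w.synchrons) : Beside (.par D) ζ := by
  rintro υ ⟨hυ, -⟩
  rw [h] at hυ
  obtain ⟨υ', -, rfl⟩ := hυ
  exact ⟨D, D', hD, rfl, υ', rfl⟩

theorem Tr.synchrons_of_name {χ : Tr E} {n : Name A C B S} (h : χ.name = n) :
    χ.synchrons = n.synchrons := congrArg _ h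

theorem Lab.Comp.isAct_left {ℓ₁ ℓ₂ ℓ : Lab C B S} (h : Lab.Comp ℓ₁ ℓ₂ ℓ) (h₁ : ℓ₁.IsAct) :
    ℓ.IsAct := by
  rcases h with ⟨-, rfl⟩ | h
  · trivial
  · cases h <;> trivial

theorem Lab.Comp.isAct_right {ℓ₁ ℓ₂ ℓ : Lab C B S} (h : Lab.Comp ℓ₁ ℓ₂ ℓ) (h₂ : ℓ₂.IsAct) :
    ℓ.IsAct := by
  rcases h with ⟨-, rfl⟩ | h
  · trivial
  · cases h <;> trivial

theorem Under.sumL {ζ v : Tr E} {Q : Proc A C B S} (h : ζ.name = .sumL v.name Q) :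
    Under (.sum .left) v ζ :=
  .of_image (Tr.synchrons_of_name h) (by simp [(Tr.of_name_sumL h).2.1])

theorem Under.sumR {ζ w : Tr E} {P : Proc A C B S} (h : ζ.name = .sumR P w.name) :
    Under (.sum .right) w ζ :=
  .of_image (Tr.synchrons_of_name h) (by simp [(Tr.of_name_sumR h).2.1])

theorem Under.parL {ζ v : Tr E} {Q : Proc A C B S} (h : ζ.name = .parL v.name Q) :
    Under (.par .left) v ζ :=
  .of_image (Tr.synchrons_of_name h) (by simp [(Tr.of_name_parL h).2.1])

theorem Under.parR {ζ w : Tr E} {P : Proc A C B S} (h : ζ.name = .parR P w.name) :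
    Under (.par .right) w ζ :=
  .of_image (Tr.synchrons_of_name h) (by simp [(Tr.of_name_parR h).2.1])

theorem Under.par_left {ζ v w : Tr E} (h : ζ.name = .par v.name w.name) :
    Under (.par .left) v ζ :=
  .of_union (by simp) (Tr.synchrons_of_name h) (Tr.of_name_par h).2.1.isAct_left

theorem Under.par_right {ζ v w : Tr E} (h : ζ.name = .par v.name w.name) :
    Under (.par .right) w ζ :=
  .of_union (D' := .left) (by simp) ((Tr.synchrons_of_name h).trans (Set.union_comm _ _))
    (Tr.of_name_par h).2.1.isAct_right

theorem Beside.parR {ζ w : Tr E} {P : Proc A C B S} (h : ζ.name = .parR P w.name) :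
    Beside (.par .left) ζ :=
  .of_image (D' := .right) (by simp) (Tr.synchrons_of_name h)

theorem Beside.parL {ζ v : Tr E} {Q : Proc A C B S} (h : ζ.name = .parL v.name Q) :
    Beside (.par .right) ζ :=
  .of_image (D' := .left) (by simp) (Tr.synchrons_of_name h)

theorem Under.res {ζ v : Tr E} {L : Set (C ⊕ S)} (h : ζ.name = .res v.name L) :
    Under (.res L) v ζ :=
  .of_image (Tr.synchrons_of_name h) (by simp [(Tr.of_name_res h).2.1])

theorem Under.rel {ζ v : Tr E} {f : Relabelling C B S} (h : ζ.name = .rel v.name f) :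
    Under (.rel f) v ζ :=
  .of_image (Tr.synchrons_of_name h) (by simp [(Tr.of_name_rel h).2.1, Relabelling.lab_isAct])

theorem Under.agent {ζ v : Tr E} {X : A} (h : ζ.name = .agent X v.name) :
    Under (.agent X) v ζ :=
  .of_image (Tr.synchrons_of_name h) (by simp [(Tr.of_name_agent h).2.2.1])

theorem Under.signal {ζ v : Tr E} {r : S} (h : ζ.name = .signal v.name r) :
    Under (.signal r) v ζ :=
  .of_image (Tr.synchrons_of_name h) (by simp [(Tr.of_name_signal h).2.1])

/-! ### Carrying synchrons over a transition -/

/-- The necessary elements of `X` are unaffected by `w`, and the elements of `X` unaffected by `w`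
occur in `Y` after `w`. -/
def Carry (X : Set (Synchron A C B S)) (w : Tr E) (Y : Set (Synchron A C B S)) : Prop :=
  (∀ ς ∈ X, ς.Necessary → ς.Unaffected w) ∧ ∀ ς ∈ X, ς.Unaffected w → ς.afterTr w ∈ Y

/-- This is the working form: `Carry` refers to sets of synchrons rather than transitions, so it can
be restricted to one component. -/
theorem possibleSuccessor_iff {t w t' : Tr E} : PossibleSuccessor t w t' ↔
    t.src = w.src ∧ t'.src = w.tgt ∧ Carry t.synchrons w t'.synchrons ∧ t.lab.Compat t'.lab := by
  rw [← Lab.compat_iff]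
  constructor
  · rintro ⟨h₁, h₂, ⟨-, h₃⟩, h₄, h₅⟩
    exact ⟨h₁, h₂, ⟨fun ς hς hn => h₃ ς ⟨hς, hn⟩, h₄⟩, h₅⟩
  · rintro ⟨h₁, h₂, ⟨h₃, h₄⟩, h₅⟩
    exact ⟨h₁, h₂, ⟨h₁, fun ς hς => h₃ ς hς.1 hς.2⟩, h₄, h₅⟩

theorem Carry.union_iff {X X' Y : Set (Synchron A C B S)} {w : Tr E} :
    Carry (X ∪ X') w Y ↔ Carry X w Y ∧ Carry X' w Y := by
  simp only [Carry, Set.mem_union, or_imp, forall_and]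
  tauto

/-- Without active synchrons everything is unaffected, and the after-function is the identity. -/
theorem Carry.of_not_isAct_iff {X Y : Set (Synchron A C B S)} {w : Tr E} (hw : ¬ w.lab.IsAct) :
    Carry X w Y ↔ X ⊆ Y := by
  simp [Carry, Synchron.Unaffected, Tr.activeSynchrons_eq_empty hw,
    Synchron.afterTr_of_not_isAct hw, Set.subset_def]

theorem Under.carry_static {ι : Arg A C B S} {v ζ : Tr E} (h : Under ι v ζ)
    (hι : ι.isStatic = true) {X Y : Set (Synchron A C B S)} :
    Carry (Synchron.cons ι '' X) ζ Y ↔ Carry X v (Synchron.cons ι ⁻¹' Y) := by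
  simp [Carry, h.unaffected_iff, h.afterTr_static hι, Synchron.necessary_cons]

theorem Under.carry_dynamic {ι : Arg A C B S} {v ζ : Tr E} (h : Under ι v ζ)
    (hι : ι.isStatic = false) (hv : v.lab.IsAct) {X Y : Set (Synchron A C B S)} :
    Carry (Synchron.cons ι '' X) ζ Y ↔ Carry X v Y := by
  simp [Carry, h.unaffected_iff, h.afterTr_dynamic hι hv, Synchron.necessary_cons]

/-- All these synchrons are unaffected and keep their form, since they diverge from `ζ` at once. -/
theorem Beside.carry {ι : Arg A C B S} {ζ : Tr E} (h : Beside ι ζ)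
    {X Y : Set (Synchron A C B S)} :
    Carry (Synchron.cons ι '' X) ζ Y ↔ X ⊆ Synchron.cons ι ⁻¹' Y := by
  simp [Carry, h.unaffected, h.afterTr_eq, Synchron.necessary_cons, Set.subset_def]

/-- If each element of `X` is affected by `w` then none of them may be necessary. -/
theorem Carry.of_affected_iff {X Y : Set (Synchron A C B S)} {w : Tr E}
    (h : ∀ ς ∈ X, ¬ ς.Unaffected w) : Carry X w Y ↔ ∀ ς ∈ X, ¬ ς.Necessary :=
  ⟨fun hc ς hς hn => h ς hς (hc.1 ς hς hn),
    fun hc => ⟨fun ς hς hn => absurd hn (hc ς hς), fun ς hς hu => absurd hu (h ς hς)⟩⟩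

theorem Synchron.not_conc_nil (l : Leaf A C B S) (υ : Synchron A C B S) :
    ¬ (⟨[], l⟩ : Synchron A C B S).Conc υ := by
  rintro ⟨σ, D, D', σ₁, σ₂, -, h, -⟩
  simp at h

theorem Synchron.not_unaffected_nil (l : Leaf A C B S) {w : Tr E} (hw : w.lab.IsAct) :
    ¬ (⟨[], l⟩ : Synchron A C B S).Unaffected w := fun h =>
  have ⟨υ, hυ⟩ := w.activeSynchrons_nonempty hw
  Synchron.not_conc_nil l υ (h υ hυ)

/-- The two diverge at a choice, so there is no later parallel composition at which they could
separate. -/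
theorem Synchron.not_conc_sum {D D' : Side} (h : D ≠ D') (ς υ : Synchron A C B S) :
    ¬ (ς.cons (.sum D)).Conc (υ.cons (.sum D')) := by
  rintro ⟨σ, _, _, σ₁, σ₂, -, h₁, h₂⟩
  cases σ with
  | nil => simp [Synchron.cons] at h₁
  | cons κ σ =>
    simp only [Synchron.cons, List.cons_append, List.cons.injEq] at h₁ h₂
    exact h (by simpa using h₁.1.trans h₂.1.symm)

theorem not_unaffected_sum {D D' : Side} (h : D ≠ D') {v ζ : Tr E} (hu : Under (.sum D') v ζ)
    (hv : v.lab.IsAct) (ς : Synchron A C B S) : ¬ (ς.cons (.sum D)).Unaffected ζ := fun hς =>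
  have ⟨υ, hυ⟩ := v.activeSynchrons_nonempty hv
  Synchron.not_conc_sum h ς υ (hς _ (hu.cons_mem υ hυ))

theorem carry_sum {D D' : Side} (h : D ≠ D') {v ζ : Tr E} (hu : Under (.sum D') v ζ)
    (hv : v.lab.IsAct) {X Y : Set (Synchron A C B S)} :
    Carry (Synchron.cons (.sum D) '' X) ζ Y ↔ ∀ ς ∈ X, ¬ ς.Necessary := by
  rw [Carry.of_affected_iff]
  · simp [Synchron.necessary_cons]
  · rintro _ ⟨ς, -, rfl⟩
    exact not_unaffected_sum h hu hv ς

theorem Synchron.cons_injective (ι : Arg A C B S) : Function.Injective (Synchron.cons ι) := by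
  rintro ⟨σ, l⟩ ⟨σ', l'⟩ h
  simpa [Synchron.cons] using h

theorem preimage_cons_image (ι : Arg A C B S) (X : Set (Synchron A C B S)) :
    Synchron.cons ι ⁻¹' (Synchron.cons ι '' X) = X :=
  Set.preimage_image_eq X (Synchron.cons_injective ι)

theorem preimage_cons_image_of_ne {ι κ : Arg A C B S} (h : ι ≠ κ) (X : Set (Synchron A C B S)) :
    Synchron.cons ι ⁻¹' (Synchron.cons κ '' X) = ∅ := by
  ext ς
  simp only [Set.mem_preimage, Set.mem_image, Set.mem_empty_iff_false, iff_false]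
  rintro ⟨υ, -, hυ⟩
  simp only [Synchron.cons, Synchron.mk.injEq, List.cons.injEq] at hυ
  exact h hυ.1.1.symm

/-- A label other than `b?` and `b:` belongs to a necessary synchron, which is unaffected and
survives with the same label. -/
theorem Carry.labCarry {X Y : Set (Synchron A C B S)} {w : Tr E} (h : Carry X w Y) :
    LabCarry (Synchron.lab '' X) (Synchron.lab '' Y) := by
  rintro _ ⟨ς, hς, rfl⟩ hn
  exact ⟨_, h.2 ς hς (h.1 ς hς (ς.necessary_iff.2 hn)), ς.lab_afterTr w⟩

theorem labCarry_of_subset {X Y : Set (Synchron A C B S)} (h : X ⊆ Y) :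
    LabCarry (Synchron.lab '' X) (Synchron.lab '' Y) := fun _ hm _ => Set.image_mono h hm


/-! ### The synchrons of the components of a transition -/

theorem preimage_parL {χ t : Tr E} {Q : Proc A C B S} (h : χ.name = .parL t.name Q) :
    Synchron.cons (.par .left) ⁻¹' χ.synchrons = t.synchrons :=
  (congrArg _ (Tr.synchrons_of_name h)).trans (preimage_cons_image _ _)

theorem preimage_parL_right {χ t : Tr E} {Q : Proc A C B S} (h : χ.name = .parL t.name Q) :
    Synchron.cons (.par .right) ⁻¹' χ.synchrons = ∅ :=
  (congrArg _ (Tr.synchrons_of_name h)).trans (preimage_cons_image_of_ne (by simp) _)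

theorem preimage_parR {χ u : Tr E} {P : Proc A C B S} (h : χ.name = .parR P u.name) :
    Synchron.cons (.par .right) ⁻¹' χ.synchrons = u.synchrons :=
  (congrArg _ (Tr.synchrons_of_name h)).trans (preimage_cons_image _ _)

theorem preimage_parR_left {χ u : Tr E} {P : Proc A C B S} (h : χ.name = .parR P u.name) :
    Synchron.cons (.par .left) ⁻¹' χ.synchrons = ∅ :=
  (congrArg _ (Tr.synchrons_of_name h)).trans (preimage_cons_image_of_ne (by simp) _)

theorem preimage_par_left {χ t u : Tr E} (h : χ.name = .par t.name u.name) :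
    Synchron.cons (.par .left) ⁻¹' χ.synchrons = t.synchrons := by
  rw [Tr.synchrons_of_name h, Name.synchrons, Set.preimage_union, preimage_cons_image,
    preimage_cons_image_of_ne (by simp), Set.union_empty]
  rfl

theorem preimage_par_right {χ t u : Tr E} (h : χ.name = .par t.name u.name) :
    Synchron.cons (.par .right) ⁻¹' χ.synchrons = u.synchrons := by
  rw [Tr.synchrons_of_name h, Name.synchrons, Set.preimage_union, preimage_cons_image,
    preimage_cons_image_of_ne (by simp), Set.empty_union]
  rfl

theorem preimage_sumL {χ t : Tr E} {Q : Proc A C B S} (h : χ.name = .sumL t.name Q) :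
    Synchron.cons (.sum .left) ⁻¹' χ.synchrons = t.synchrons :=
  (congrArg _ (Tr.synchrons_of_name h)).trans (preimage_cons_image _ _)

theorem preimage_sumL_right {χ t : Tr E} {Q : Proc A C B S} (h : χ.name = .sumL t.name Q) :
    Synchron.cons (.sum .right) ⁻¹' χ.synchrons = ∅ :=
  (congrArg _ (Tr.synchrons_of_name h)).trans (preimage_cons_image_of_ne (by simp) _)

theorem preimage_sumR {χ u : Tr E} {P : Proc A C B S} (h : χ.name = .sumR P u.name) :
    Synchron.cons (.sum .right) ⁻¹' χ.synchrons = u.synchrons :=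
  (congrArg _ (Tr.synchrons_of_name h)).trans (preimage_cons_image _ _)

theorem preimage_sumR_left {χ u : Tr E} {P : Proc A C B S} (h : χ.name = .sumR P u.name) :
    Synchron.cons (.sum .left) ⁻¹' χ.synchrons = ∅ :=
  (congrArg _ (Tr.synchrons_of_name h)).trans (preimage_cons_image_of_ne (by simp) _)

theorem preimage_sum_left {χ t u : Tr E} (h : χ.name = .sum t.name u.name) :
    Synchron.cons (.sum .left) ⁻¹' χ.synchrons = t.synchrons := by
  rw [Tr.synchrons_of_name h, Name.synchrons, Set.preimage_union, preimage_cons_image,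
    preimage_cons_image_of_ne (by simp), Set.union_empty]
  rfl

theorem preimage_sum_right {χ t u : Tr E} (h : χ.name = .sum t.name u.name) :
    Synchron.cons (.sum .right) ⁻¹' χ.synchrons = u.synchrons := by
  rw [Tr.synchrons_of_name h, Name.synchrons, Set.preimage_union, preimage_cons_image,
    preimage_cons_image_of_ne (by simp), Set.empty_union]
  rfl

theorem preimage_res {χ t : Tr E} {L : Set (C ⊕ S)} (h : χ.name = .res t.name L) :
    Synchron.cons (.res L) ⁻¹' χ.synchrons = t.synchrons :=
  (congrArg _ (Tr.synchrons_of_name h)).trans (preimage_cons_image _ _)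

theorem preimage_rel {χ t : Tr E} {f : Relabelling C B S} (h : χ.name = .rel t.name f) :
    Synchron.cons (.rel f) ⁻¹' χ.synchrons = t.synchrons :=
  (congrArg _ (Tr.synchrons_of_name h)).trans (preimage_cons_image _ _)

theorem preimage_agent {χ t : Tr E} {X : A} (h : χ.name = .agent X t.name) :
    Synchron.cons (.agent X) ⁻¹' χ.synchrons = t.synchrons :=
  (congrArg _ (Tr.synchrons_of_name h)).trans (preimage_cons_image _ _)

theorem preimage_signal {χ t : Tr E} {r : S} (h : χ.name = .signal t.name r) :
    Synchron.cons (.signal r) ⁻¹' χ.synchrons = t.synchrons :=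
  (congrArg _ (Tr.synchrons_of_name h)).trans (preimage_cons_image _ _)

/-! ### Inductively defined successors are possible successors -/

theorem carry_nil {l : Leaf A C B S} {w : Tr E} (hw : w.lab.IsAct)
    {Y : Set (Synchron A C B S)} :
    Carry {⟨[], l⟩} w Y ↔ ¬ (⟨[], l⟩ : Synchron A C B S).Necessary := by
  rw [Carry.of_affected_iff]
  · simp
  · rintro _ rfl
    exact Synchron.not_unaffected_nil l hw

theorem LeadsTo.possibleSuccessor {χ ζ χ' : Tr E} (h : LeadsTo χ ζ χ') :
    PossibleSuccessor χ ζ χ' := by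
  rw [possibleSuccessor_iff]
  induction h with
  | passive hζ hs =>
    exact ⟨hs.symm, by rw [Tr.tgt_eq_src hζ, hs], (Carry.of_not_isAct_iff hζ).2 subset_rfl,
      .refl _⟩
  | @recv χ ζ t b P hχ hζ ht hl =>
    obtain ⟨s₁, l₁, -⟩ := Tr.of_name_act hχ
    obtain ⟨s₂, l₂, g₂⟩ := Tr.of_name_act hζ
    refine ⟨s₁.trans s₂.symm, ht.trans g₂.symm, ?_, .inr ⟨b, .inl l₁, hl⟩⟩
    rw [Tr.synchrons_of_name hχ, Name.synchrons, carry_nil (by rw [l₂]; trivial)]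
    exact fun h => h (.inl ⟨_, _, rfl⟩)
  | @disc χ ζ t b α P hχ hζ ht hl =>
    obtain ⟨s₁, l₁⟩ := Tr.of_name_disAct hχ
    obtain ⟨s₂, l₂, g₂⟩ := Tr.of_name_act hζ
    refine ⟨s₁.trans s₂.symm, ht.trans g₂.symm, ?_, .inr ⟨b, .inr l₁, hl⟩⟩
    rw [Tr.synchrons_of_name hχ, Name.synchrons, carry_nil (by rw [l₂]; trivial)]
    exact fun h => h (.inr ⟨_, rfl⟩)
  | sumLL hχ hζ hs ht' hv _ ih =>
    obtain ⟨s₁, l₁, -⟩ := Tr.of_name_sumL hχ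
    obtain ⟨s₂, -, g₂⟩ := Tr.of_name_sumL hζ
    obtain ⟨hv, g₂⟩ := g₂.resolve_left hv
    obtain ⟨-, -, ih, l⟩ := ih
    refine ⟨by rw [s₁, s₂, hs], ht'.trans g₂.symm, ?_, by rwa [l₁]⟩
    rw [Tr.synchrons_of_name hχ]
    exact ((Under.sumL hζ).carry_dynamic rfl hv).2 ih
  | sumRR hχ hζ hs ht' hv _ ih =>
    obtain ⟨s₁, l₁, -⟩ := Tr.of_name_sumR hχ
    obtain ⟨s₂, -, g₂⟩ := Tr.of_name_sumR hζ
    obtain ⟨hv, g₂⟩ := g₂.resolve_left hv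
    obtain ⟨-, -, ih, l⟩ := ih
    refine ⟨by rw [s₁, s₂, hs], ht'.trans g₂.symm, ?_, by rwa [l₁]⟩
    rw [Tr.synchrons_of_name hχ]
    exact ((Under.sumR hζ).carry_dynamic rfl hv).2 ih
  | @sumBL χ ζ t u v t' hχ hζ hs ht' hv _ ih =>
    obtain ⟨s₁, b, l₁, lt, lu⟩ := Tr.of_name_sum hχ
    obtain ⟨s₂, -, g₂⟩ := Tr.of_name_sumL hζ
    obtain ⟨hv, g₂⟩ := g₂.resolve_left hv
    obtain ⟨-, -, ih, l⟩ := ih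
    refine ⟨by rw [s₁, s₂, hs], ht'.trans g₂.symm, ?_, by rwa [l₁, ← lt]⟩
    rw [Tr.synchrons_of_name hχ]
    -- The synchrons of `u` are all affected by the choice for `v`, which is harmless as `u` is a
    -- discard.
    exact Carry.union_iff.2 ⟨((Under.sumL hζ).carry_dynamic rfl hv).2 ih,
      (carry_sum (by simp) (Under.sumL hζ) hv).2
        (u.forall_not_necessary_iff.2 ⟨b, .inr lu⟩)⟩
  | @sumBR χ ζ t u w u' hχ hζ hs hu' hw _ ih =>
    obtain ⟨s₁, b, l₁, lt, lu⟩ := Tr.of_name_sum hχ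
    obtain ⟨s₂, -, g₂⟩ := Tr.of_name_sumR hζ
    obtain ⟨hw, g₂⟩ := g₂.resolve_left hw
    obtain ⟨-, -, ih, l⟩ := ih
    refine ⟨by rw [s₁, s₂, hs], hu'.trans g₂.symm, ?_, by rwa [l₁, ← lu]⟩
    rw [Tr.synchrons_of_name hχ]
    exact Carry.union_iff.2 ⟨(carry_sum (by simp) (Under.sumR hζ) hw).2
        (t.forall_not_necessary_iff.2 ⟨b, .inr lt⟩),
      ((Under.sumR hζ).carry_dynamic rfl hw).2 ih⟩
  | @sumLR χ ζ t w u' b hχ hζ hu' hw hb hl =>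
    obtain ⟨s₁, l₁, -⟩ := Tr.of_name_sumL hχ
    obtain ⟨s₂, -, g₂⟩ := Tr.of_name_sumR hζ
    obtain ⟨hw, g₂⟩ := g₂.resolve_left hw
    refine ⟨by rw [s₁, s₂], hu'.trans g₂.symm, ?_, .inr ⟨b, .inl (l₁.trans hb), hl⟩⟩
    rw [Tr.synchrons_of_name hχ]
    exact (carry_sum (by simp) (Under.sumR hζ) hw).2
        (t.forall_not_necessary_iff.2 ⟨b, .inl hb⟩)
  | @sumRL χ ζ u v t' b hχ hζ ht' hv hb hl =>
    obtain ⟨s₁, l₁, -⟩ := Tr.of_name_sumR hχ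
    obtain ⟨s₂, -, g₂⟩ := Tr.of_name_sumL hζ
    obtain ⟨hv, g₂⟩ := g₂.resolve_left hv
    refine ⟨by rw [s₁, s₂], ht'.trans g₂.symm, ?_, .inr ⟨b, .inl (l₁.trans hb), hl⟩⟩
    rw [Tr.synchrons_of_name hχ]
    exact (carry_sum (by simp) (Under.sumL hζ) hv).2
        (u.forall_not_necessary_iff.2 ⟨b, .inl hb⟩)
  | parLR hχ hζ hχ' =>
    obtain ⟨s₁, l₁, -⟩ := Tr.of_name_parL hχ
    obtain ⟨s₂, -, g₂, -⟩ := Tr.of_name_parR hζ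
    obtain ⟨s₃, l₃, -⟩ := Tr.of_name_parL hχ'
    refine ⟨by rw [s₁, s₂], by rw [s₃, g₂], ?_, .inl (l₁.trans l₃.symm)⟩
    rw [Tr.synchrons_of_name hχ]
    exact (Beside.parR hζ).carry.2 (preimage_parL hχ').ge
  | parRL hχ hζ hχ' =>
    obtain ⟨s₁, l₁, -⟩ := Tr.of_name_parR hχ
    obtain ⟨s₂, -, g₂, -⟩ := Tr.of_name_parL hζ
    obtain ⟨s₃, l₃, -⟩ := Tr.of_name_parR hχ'
    refine ⟨by rw [s₁, s₂], by rw [s₃, g₂], ?_, .inl (l₁.trans l₃.symm)⟩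
    rw [Tr.synchrons_of_name hχ]
    exact (Beside.parL hζ).carry.2 (preimage_parR hχ').ge
  | parLL hχ hζ hχ' hs ht' _ ih =>
    obtain ⟨s₁, l₁, -⟩ := Tr.of_name_parL hχ
    obtain ⟨s₂, -, g₂, -⟩ := Tr.of_name_parL hζ
    obtain ⟨s₃, l₃, -⟩ := Tr.of_name_parL hχ'
    obtain ⟨-, -, ih, l⟩ := ih
    refine ⟨by rw [s₁, s₂, hs], by rw [s₃, g₂, ht'], ?_, by rwa [l₁, l₃]⟩
    rw [Tr.synchrons_of_name hχ]
    exact ((Under.parL hζ).carry_static rfl).2 (by rwa [preimage_parL hχ'])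
  | parRR hχ hζ hχ' hs ht' _ ih =>
    obtain ⟨s₁, l₁, -⟩ := Tr.of_name_parR hχ
    obtain ⟨s₂, -, g₂, -⟩ := Tr.of_name_parR hζ
    obtain ⟨s₃, l₃, -⟩ := Tr.of_name_parR hχ'
    obtain ⟨-, -, ih, l⟩ := ih
    refine ⟨by rw [s₁, s₂, hs], by rw [s₃, g₂, ht'], ?_, by rwa [l₁, l₃]⟩
    rw [Tr.synchrons_of_name hχ]
    exact ((Under.parR hζ).carry_static rfl).2 (by rwa [preimage_parR hχ'])
  | parLB hχ hζ hχ' hs ht' _ ih =>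
    obtain ⟨s₁, l₁, -⟩ := Tr.of_name_parL hχ
    obtain ⟨s₂, -, g₂⟩ := Tr.of_name_par hζ
    obtain ⟨s₃, l₃, -⟩ := Tr.of_name_parL hχ'
    obtain ⟨-, -, ih, l⟩ := ih
    refine ⟨by rw [s₁, s₂, hs], by rw [s₃, g₂, ht'], ?_, by rwa [l₁, l₃]⟩
    rw [Tr.synchrons_of_name hχ]
    exact ((Under.par_left hζ).carry_static rfl).2 (by rwa [preimage_parL hχ'])
  | parRB hχ hζ hχ' hs ht' _ ih =>
    obtain ⟨s₁, l₁, -⟩ := Tr.of_name_parR hχ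
    obtain ⟨s₂, -, g₂⟩ := Tr.of_name_par hζ
    obtain ⟨s₃, l₃, -⟩ := Tr.of_name_parR hχ'
    obtain ⟨-, -, ih, l⟩ := ih
    refine ⟨by rw [s₁, s₂, hs], by rw [s₃, g₂, ht'], ?_, by rwa [l₁, l₃]⟩
    rw [Tr.synchrons_of_name hχ]
    exact ((Under.par_right hζ).carry_static rfl).2 (by rwa [preimage_parR hχ'])
  | parBL hχ hζ hχ' hs ht' _ ih =>
    obtain ⟨s₁, c₁, -⟩ := Tr.of_name_par hχ
    obtain ⟨s₂, -, g₂, -⟩ := Tr.of_name_parL hζ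
    obtain ⟨s₃, c₃, -⟩ := Tr.of_name_par hχ'
    obtain ⟨-, -, ih, l⟩ := ih
    refine ⟨by rw [s₁, s₂, hs], by rw [s₃, g₂, ht'], ?_, l.comp (.refl _) c₁ c₃⟩
    rw [Tr.synchrons_of_name hχ]
    -- The right component is idle in `ζ`, so its synchrons are kept literally.
    exact Carry.union_iff.2
      ⟨((Under.parL hζ).carry_static rfl).2 (by rwa [preimage_par_left hχ']),
        (Beside.parL hζ).carry.2 (preimage_par_right hχ').ge⟩
  | parBR hχ hζ hχ' hs ht' _ ih =>
    obtain ⟨s₁, c₁, -⟩ := Tr.of_name_par hχ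
    obtain ⟨s₂, -, g₂, -⟩ := Tr.of_name_parR hζ
    obtain ⟨s₃, c₃, -⟩ := Tr.of_name_par hχ'
    obtain ⟨-, -, ih, l⟩ := ih
    refine ⟨by rw [s₁, s₂, hs], by rw [s₃, g₂, ht'], ?_, (Lab.Compat.refl _).comp l c₁ c₃⟩
    rw [Tr.synchrons_of_name hχ]
    exact Carry.union_iff.2
      ⟨(Beside.parR hζ).carry.2 (preimage_par_left hχ').ge,
        ((Under.parR hζ).carry_static rfl).2 (by rwa [preimage_par_right hχ'])⟩
  | parBB hχ hζ hχ' hst ht' hsu hu' _ _ iht ihu =>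
    obtain ⟨s₁, c₁, -⟩ := Tr.of_name_par hχ
    obtain ⟨s₂, -, g₂⟩ := Tr.of_name_par hζ
    obtain ⟨s₃, c₃, -⟩ := Tr.of_name_par hχ'
    obtain ⟨-, -, iht, lt⟩ := iht
    obtain ⟨-, -, ihu, lu⟩ := ihu
    refine ⟨by rw [s₁, s₂, hst, hsu], by rw [s₃, g₂, ht', hu'], ?_, lt.comp lu c₁ c₃⟩
    rw [Tr.synchrons_of_name hχ]
    exact Carry.union_iff.2
      ⟨((Under.par_left hζ).carry_static rfl).2 (by rwa [preimage_par_left hχ']),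
        ((Under.par_right hζ).carry_static rfl).2 (by rwa [preimage_par_right hχ'])⟩
  | res hχ hζ hχ' hs ht' _ _ ih =>
    obtain ⟨s₁, l₁, -⟩ := Tr.of_name_res hχ
    obtain ⟨s₂, -, g₂⟩ := Tr.of_name_res hζ
    obtain ⟨s₃, l₃, -⟩ := Tr.of_name_res hχ'
    obtain ⟨-, -, ih, l⟩ := ih
    refine ⟨by rw [s₁, s₂, hs], by rw [s₃, g₂, ht'], ?_, by rwa [l₁, l₃]⟩
    rw [Tr.synchrons_of_name hχ]
    exact ((Under.res hζ).carry_static rfl).2 (by rwa [preimage_res hχ'])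
  | rel hχ hζ hχ' hs ht' _ _ ih =>
    obtain ⟨s₁, l₁, -⟩ := Tr.of_name_rel hχ
    obtain ⟨s₂, -, g₂⟩ := Tr.of_name_rel hζ
    obtain ⟨s₃, l₃, -⟩ := Tr.of_name_rel hχ'
    obtain ⟨-, -, ih, l⟩ := ih
    refine ⟨by rw [s₁, s₂, hs], by rw [s₃, g₂, ht'], ?_, by rw [l₁, l₃]; exact l.relabel _⟩
    rw [Tr.synchrons_of_name hχ]
    exact ((Under.rel hζ).carry_static rfl).2 (by rwa [preimage_rel hχ'])
  | agent hχ hζ hs ht' hv _ ih =>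
    obtain ⟨s₁, -, l₁, -⟩ := Tr.of_name_agent hχ
    obtain ⟨s₂, -, -, g₂⟩ := Tr.of_name_agent hζ
    obtain ⟨-, -, ih, l⟩ := ih
    refine ⟨by rw [s₁, s₂], ht'.trans (g₂ hv).symm, ?_, by rwa [l₁]⟩
    rw [Tr.synchrons_of_name hχ]
    exact ((Under.agent hζ).carry_dynamic rfl hv).2 ih
  | signal hχ hζ hs ht' hv _ ih =>
    obtain ⟨s₁, l₁, -⟩ := Tr.of_name_signal hχ
    obtain ⟨s₂, -, g₂⟩ := Tr.of_name_signal hζ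
    obtain ⟨-, -, ih, l⟩ := ih
    refine ⟨by rw [s₁, s₂, hs], ht'.trans (g₂ hv).symm, ?_, by rwa [l₁]⟩
    rw [Tr.synchrons_of_name hχ]
    exact ((Under.signal hζ).carry_dynamic rfl hv).2 ih


/-! ### Possible successors are inductively defined successors -/

theorem Tr.RelabelsInjectively.of_cons {χ t : Tr E} (h : χ.RelabelsInjectively) {ι : Arg A C B S}
    (ht : Synchron.cons ι ⁻¹' χ.synchrons = t.synchrons) : t.RelabelsInjectively :=
  fun _ hς f hf => h _ (ht.ge hς) f (List.mem_cons_of_mem _ hf)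

theorem Tr.RelabelsInjectively.injective {χ t : Tr E} {f : Relabelling C B S}
    (h : χ.RelabelsInjectively) (hχ : χ.name = .rel t.name f) : Function.Injective f.onB :=
  have ⟨_, hς⟩ := t.synchrons_nonempty
  h _ ((preimage_rel hχ).ge hς) f List.mem_cons_self

/-- The labels of the synchrons of `χ` that start with `ι`, with `ι` removed. -/
def Tr.labsAt (χ : Tr E) (ι : Arg A C B S) : Set (Lab C B S) :=
  Synchron.lab '' (Synchron.cons ι ⁻¹' χ.synchrons)

/-! ### The shape of successors under parallel composition -/

theorem Lab.Comp.of_isEta {ℓ₁ ℓ₂ ℓ : Lab C B S} (h : Lab.Comp ℓ₁ ℓ₂ ℓ) (hη : ℓ.IsEta) :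
    Lab.Compl ℓ₁ ℓ₂ ∧ ℓ = .act .tau := by
  rcases h with h | h
  · exact h
  · cases h <;> exact hη.elim

/-- Some necessary synchron of `t` survives on the left, so `χ'` involves the left component. If it
also involved the right one, its non-broadcast label would make it a handshake labelled `τ`, and
`t`, itself labelled `τ`, would be followed by a handshake partner. -/
theorem Tr.name_parL_of_compat {χ χ' t : Tr E} {Q P' Q' : Proc A C B S}
    (hχ : χ.name = .parL t.name Q) (hχ' : χ'.src = .par P' Q') (hl : χ.lab.Compat χ'.lab)
    (hc : LabCarry t.labs (χ'.labsAt (.par .left))) :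
    ∃ t' : Tr E, t'.src = P' ∧ χ'.name = .parL t'.name Q' := by
  obtain ⟨-, l, -, hη⟩ := Tr.of_name_parL hχ
  have hl := hl.eq (l ▸ hη.not_isRecvOrDisc)
  rcases Tr.of_src_par hχ' with h | ⟨u', -, h⟩ | ⟨t', u', -, -, h⟩
  · exact h
  · exfalso
    have hn : ∃ ς ∈ t.synchrons, ς.Necessary := by
      by_contra! hn
      exact hη.not_isRecvOrDisc (t.forall_not_necessary_iff.1 hn)
    obtain ⟨ς, hς, hn⟩ := hn
    simpa [Tr.labsAt, preimage_parR_left h] using hc _ ⟨ς, hς, rfl⟩ (ς.necessary_iff.1 hn)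
  · exfalso
    rw [Tr.labsAt, preimage_par_left h] at hc
    obtain ⟨hcompl, e⟩ := (Tr.of_name_par h).2.1.of_isEta (by rwa [← hl, l])
    have ht := t.labSpec
    rw [← l, hl, e] at ht
    exact hc.not_compl_of_tau ht t'.labSpec hcompl

theorem Tr.name_parR_of_compat {χ χ' u : Tr E} {P P' Q' : Proc A C B S}
    (hχ : χ.name = .parR P u.name) (hχ' : χ'.src = .par P' Q') (hl : χ.lab.Compat χ'.lab)
    (hc : LabCarry u.labs (χ'.labsAt (.par .right))) :
    ∃ u' : Tr E, u'.src = Q' ∧ χ'.name = .parR P' u'.name := by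
  obtain ⟨-, l, -, hη⟩ := Tr.of_name_parR hχ
  have hl := hl.eq (l ▸ hη.not_isRecvOrDisc)
  rcases Tr.of_src_par hχ' with ⟨t', -, h⟩ | h | ⟨t', u', -, -, h⟩
  · exfalso
    have hn : ∃ ς ∈ u.synchrons, ς.Necessary := by
      by_contra! hn
      exact hη.not_isRecvOrDisc (u.forall_not_necessary_iff.1 hn)
    obtain ⟨ς, hς, hn⟩ := hn
    simpa [Tr.labsAt, preimage_parL_right h] using hc _ ⟨ς, hς, rfl⟩ (ς.necessary_iff.1 hn)
  · exact h
  · exfalso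
    rw [Tr.labsAt, preimage_par_right h] at hc
    obtain ⟨hcompl, e⟩ := (Tr.of_name_par h).2.1.of_isEta (by rwa [← hl, l])
    have hu := u.labSpec
    rw [← l, hl, e] at hu
    exact hc.not_compl_of_tau hu u'.labSpec hcompl.symm

/-- A successor involving one component only has a non-broadcast label, so `χ` is a handshake; but
then the necessary synchrons of both partners survive. Knowing the shape, `LabCarry.compat_of_comp`
transfers compatibility to the components. -/
theorem Tr.name_par_of_compat {χ χ' t u : Tr E} {P' Q' : Proc A C B S}
    (hχ : χ.name = .par t.name u.name) (hχ' : χ'.src = .par P' Q') (hl : χ.lab.Compat χ'.lab)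
    (hct : LabCarry t.labs (χ'.labsAt (.par .left)))
    (hcu : LabCarry u.labs (χ'.labsAt (.par .right))) :
    ∃ t' u' : Tr E, t'.src = P' ∧ u'.src = Q' ∧ χ'.name = .par t'.name u'.name ∧
      t.lab.Compat t'.lab ∧ u.lab.Compat u'.lab := by
  obtain ⟨-, hcomp, -⟩ := Tr.of_name_par hχ
  rcases Tr.of_src_par hχ' with ⟨t', -, h⟩ | ⟨u', -, h⟩ | ⟨t', u', ht', hu', h⟩
  · exfalso
    obtain ⟨-, l', -, hη⟩ := Tr.of_name_parL h
    obtain ⟨hcompl, -⟩ := hcomp.of_isEta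
      (by rwa [← hl.symm.eq (l' ▸ hη.not_isRecvOrDisc), l'])
    obtain ⟨m, hm⟩ := u.labs_nonempty
    have hm' := hcu m hm (by
      rw [hcompl.labSpec_right u.labSpec m hm]
      exact hcompl.symm.not_isRecvOrDisc)
    simp [Tr.labsAt, preimage_parL_right h] at hm'
  · exfalso
    obtain ⟨-, l', -, hη⟩ := Tr.of_name_parR h
    obtain ⟨hcompl, -⟩ := hcomp.of_isEta
      (by rwa [← hl.symm.eq (l' ▸ hη.not_isRecvOrDisc), l'])
    obtain ⟨m, hm⟩ := t.labs_nonempty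
    have hm' := hct m hm (by
      rw [hcompl.labSpec_left t.labSpec m hm]
      exact hcompl.not_isRecvOrDisc)
    simp [Tr.labsAt, preimage_parR_left h] at hm'
  · rw [Tr.labsAt, preimage_par_left h] at hct
    rw [Tr.labsAt, preimage_par_right h] at hcu
    exact ⟨t', u', ht', hu', h, hct.compat_of_comp hcu t.labs_nonempty u.labs_nonempty t.labSpec
      u.labSpec t'.labSpec u'.labSpec hcomp (Tr.of_name_par h).2.1 hl⟩

/-- A receive has an active synchron, which a discard cannot contain. This separates `t + Q` from a
discard `t' + u'` whose synchrons include those of `t + Q`. -/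
theorem Tr.not_isRecvOrDisc_of_synchrons_subset {t t' : Tr E} {b : B}
    (ht : t.synchrons ⊆ t'.synchrons)
    (hact : t.lab.IsEmit ∨ t.lab.IsAct) (h' : t'.lab = .disc b) : ¬ t.lab.IsRecvOrDisc b := by
  rintro (h | h)
  · obtain ⟨ς, hς, ha⟩ := t.activeSynchrons_nonempty (by rw [h]; trivial)
    have he := t'.activeSynchrons_eq_empty (by rw [h']; exact id)
    exact he.le ⟨ht hς, ha⟩
  · rw [h] at hact
    exact hact.elim id id

/-- A transition is determined by its source, its set of synchrons and its label; more precisely,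
it suffices to have an inclusion of the sets of synchrons, and compatible labels. -/
theorem Tr.eq_of_synchrons_subset {χ χ' : Tr E} (hi : χ.RelabelsInjectively)
    (hs : χ.src = χ'.src) (hsub : χ.synchrons ⊆ χ'.synchrons) (hl : χ.lab.Compat χ'.lab) :
    χ = χ' := by
  apply Tr.name_injective
  induction χ using Tr.name_induction generalizing χ' with
  | act χ α P h =>
    rcases Tr.of_src_pre (hs.symm.trans (Tr.of_name_act h).1) with h' | ⟨b, h'⟩
    · rw [h, h']
    · rw [Tr.synchrons_of_name h, Tr.synchrons_of_name h'] at hsub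
      simp [Name.synchrons] at hsub
  | disNil χ b h =>
    obtain ⟨b', h'⟩ := Tr.of_src_nil (hs.symm.trans (Tr.of_name_disNil h).1)
    rw [Tr.synchrons_of_name h, Tr.synchrons_of_name h'] at hsub
    simp [Name.synchrons] at hsub
    rw [h, h', hsub]
  | disAct χ b α P h =>
    rcases Tr.of_src_pre (hs.symm.trans (Tr.of_name_disAct h).1) with h' | ⟨b', h'⟩ <;>
      rw [Tr.synchrons_of_name h, Tr.synchrons_of_name h'] at hsub <;>
      simp [Name.synchrons] at hsub
    rw [h, h', hsub]
  | sig χ P s h =>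
    rcases Tr.of_src_signal (hs.symm.trans (Tr.of_name_sig h).1) with h' | ⟨t', -, h'⟩
    · rw [h, h']
    · rw [Tr.synchrons_of_name h, Tr.synchrons_of_name h'] at hsub
      simp [Name.synchrons, Synchron.cons] at hsub
  | sumL χ t Q h ih =>
    obtain ⟨s, l, ha⟩ := Tr.of_name_sumL h
    have ht := Set.preimage_mono (f := Synchron.cons (.sum .left)) hsub
    rw [preimage_sumL h] at ht
    rcases Tr.of_src_sum (hs.symm.trans s) with ⟨t', ht', h'⟩ | ⟨u', -, h'⟩ | ⟨t', u', -, -, h'⟩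
    · rw [preimage_sumL h'] at ht
      rw [h, h', ih (hi.of_cons (preimage_sumL h)) ht'.symm ht
        (by rwa [← l, ← (Tr.of_name_sumL h').2.1])]
    · rw [preimage_sumR_left h'] at ht
      exact absurd t.synchrons_nonempty (by simp [Set.subset_empty_iff.1 ht])
    · rw [preimage_sum_left h'] at ht
      obtain ⟨-, b, l', lt', -⟩ := Tr.of_name_sum h'
      -- Here `χ'` is a discard, so compatibility would make `t` a receive or a discard.
      exact absurd (l ▸ hl.symm.isRecvOrDisc (.inr l'))
        (Tr.not_isRecvOrDisc_of_synchrons_subset ht (ha.imp id And.left) lt')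
  | sumR χ u P h ih =>
    obtain ⟨s, l, ha⟩ := Tr.of_name_sumR h
    have hu := Set.preimage_mono (f := Synchron.cons (.sum .right)) hsub
    rw [preimage_sumR h] at hu
    rcases Tr.of_src_sum (hs.symm.trans s) with ⟨t', -, h'⟩ | ⟨u', hu', h'⟩ | ⟨t', u', -, -, h'⟩
    · rw [preimage_sumL_right h'] at hu
      exact absurd u.synchrons_nonempty (by simp [Set.subset_empty_iff.1 hu])
    · rw [preimage_sumR h'] at hu
      rw [h, h', ih (hi.of_cons (preimage_sumR h)) hu'.symm hu
        (by rwa [← l, ← (Tr.of_name_sumR h').2.1])]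
    · rw [preimage_sum_right h'] at hu
      obtain ⟨-, b, l', -, lu'⟩ := Tr.of_name_sum h'
      exact absurd (l ▸ hl.symm.isRecvOrDisc (.inr l'))
        (Tr.not_isRecvOrDisc_of_synchrons_subset hu (ha.imp id And.left) lu')
  | sum χ t u h iht ihu =>
    obtain ⟨s, b, l, lt, lu⟩ := Tr.of_name_sum h
    have ht := Set.preimage_mono (f := Synchron.cons (.sum .left)) hsub
    have hu := Set.preimage_mono (f := Synchron.cons (.sum .right)) hsub
    rw [preimage_sum_left h] at ht
    rw [preimage_sum_right h] at hu
    rcases Tr.of_src_sum (hs.symm.trans s) with ⟨t', -, h'⟩ | ⟨u', -, h'⟩ | ⟨t', u', ht', hu', h'⟩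
    · rw [preimage_sumL_right h'] at hu
      exact absurd u.synchrons_nonempty (by simp [Set.subset_empty_iff.1 hu])
    · rw [preimage_sumR_left h'] at ht
      exact absurd t.synchrons_nonempty (by simp [Set.subset_empty_iff.1 ht])
    · rw [preimage_sum_left h'] at ht
      rw [preimage_sum_right h'] at hu
      obtain ⟨-, b', l', lt', lu'⟩ := Tr.of_name_sum h'
      rw [l, l'] at hl
      rw [h, h', iht (hi.of_cons (preimage_sum_left h)) ht'.symm ht (by rwa [lt, lt']),
        ihu (hi.of_cons (preimage_sum_right h)) hu'.symm hu
        (by rwa [lu, lu'])]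
  | parL χ t Q h ih =>
    obtain ⟨s, l, -⟩ := Tr.of_name_parL h
    have ht := Set.preimage_mono (f := Synchron.cons (.par .left)) hsub
    rw [preimage_parL h] at ht
    obtain ⟨t', ht', h'⟩ :=
      Tr.name_parL_of_compat h (hs.symm.trans s) hl (labCarry_of_subset ht)
    rw [preimage_parL h'] at ht
    rw [h, h', ih (hi.of_cons (preimage_parL h)) ht'.symm ht
        (by rwa [← l, ← (Tr.of_name_parL h').2.1])]
  | parR χ u P h ih =>
    obtain ⟨s, l, -⟩ := Tr.of_name_parR h
    have hu := Set.preimage_mono (f := Synchron.cons (.par .right)) hsub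
    rw [preimage_parR h] at hu
    obtain ⟨u', hu', h'⟩ :=
      Tr.name_parR_of_compat h (hs.symm.trans s) hl (labCarry_of_subset hu)
    rw [preimage_parR h'] at hu
    rw [h, h', ih (hi.of_cons (preimage_parR h)) hu'.symm hu
        (by rwa [← l, ← (Tr.of_name_parR h').2.1])]
  | par χ t u h iht ihu =>
    have ht := Set.preimage_mono (f := Synchron.cons (.par .left)) hsub
    have hu := Set.preimage_mono (f := Synchron.cons (.par .right)) hsub
    rw [preimage_par_left h] at ht
    rw [preimage_par_right h] at hu
    obtain ⟨t', u', ht', hu', h', lt, lu⟩ := Tr.name_par_of_compat h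
      (hs.symm.trans (Tr.of_name_par h).1) hl (labCarry_of_subset ht) (labCarry_of_subset hu)
    rw [preimage_par_left h'] at ht
    rw [preimage_par_right h'] at hu
    rw [h, h', iht (hi.of_cons (preimage_par_left h)) ht'.symm ht lt,
      ihu (hi.of_cons (preimage_par_right h)) hu'.symm hu lu]
  | res χ t L h ih =>
    obtain ⟨s, l, -⟩ := Tr.of_name_res h
    obtain ⟨t', ht', h'⟩ := Tr.of_src_res (hs.symm.trans s)
    have ht := Set.preimage_mono (f := Synchron.cons (.res L)) hsub
    rw [preimage_res h, preimage_res h'] at ht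
    rw [h, h', ih (hi.of_cons (preimage_res h)) ht'.symm ht
        (by rwa [← l, ← (Tr.of_name_res h').2.1])]
  | rel χ t f h ih =>
    obtain ⟨s, l, -⟩ := Tr.of_name_rel h
    obtain ⟨t', ht', h'⟩ := Tr.of_src_rel (hs.symm.trans s)
    have ht := Set.preimage_mono (f := Synchron.cons (.rel f)) hsub
    rw [preimage_rel h, preimage_rel h'] at ht
    rw [l, (Tr.of_name_rel h').2.1] at hl
    rw [h, h', ih (hi.of_cons (preimage_rel h)) ht'.symm ht
      -- Compatibility is only given after relabelling and has to be pulled back through `f`.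
      ((labCarry_of_subset ht).compat_of_relabel t.labs_nonempty t.labSpec t'.labSpec
        (hi.injective h) hl)]
  | agent χ t X h ih =>
    obtain ⟨s, s', l, -⟩ := Tr.of_name_agent h
    obtain ⟨t', ht', h'⟩ := Tr.of_src_agent (hs.symm.trans s)
    have ht := Set.preimage_mono (f := Synchron.cons (.agent X)) hsub
    rw [preimage_agent h, preimage_agent h'] at ht
    rw [h, h', ih (hi.of_cons (preimage_agent h)) (s'.trans ht'.symm) ht
        (by rwa [← l, ← (Tr.of_name_agent h').2.2.1])]
  | signal χ t r h ih =>
    obtain ⟨s, l, -⟩ := Tr.of_name_signal h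
    have ht := Set.preimage_mono (f := Synchron.cons (.signal r)) hsub
    rw [preimage_signal h] at ht
    rcases Tr.of_src_signal (hs.symm.trans s) with h' | ⟨t', ht', h'⟩
    · obtain ⟨ς, hς⟩ := t.synchrons_nonempty
      have := ht hς
      rw [Set.mem_preimage, Tr.synchrons_of_name h'] at this
      simp [Name.synchrons, Synchron.cons] at this
    · rw [preimage_signal h'] at ht
      rw [h, h', ih (hi.of_cons (preimage_signal h)) ht'.symm ht
        (by rwa [← l, ← (Tr.of_name_signal h').2.1])]

/-- Such a `ζ` changes no state and affects no synchron, so `χ'` has the source of `χ` and contains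
its synchrons; hence it is `χ`. -/
theorem LeadsTo.of_not_isAct {χ ζ χ' : Tr E} (hi : χ.RelabelsInjectively)
    (h : PossibleSuccessor χ ζ χ') (hζ : ¬ ζ.lab.IsAct) : LeadsTo χ ζ χ' := by
  obtain ⟨hs, hs', hc, hl⟩ := possibleSuccessor_iff.1 h
  rw [Tr.tgt_eq_src hζ] at hs'
  obtain rfl := Tr.eq_of_synchrons_subset hi (hs.trans hs'.symm)
    ((Carry.of_not_isAct_iff hζ).1 hc) hl
  exact .passive hζ hs'.symm


theorem Lab.IsAct.not_isEmit {ℓ : Lab C B S} (h : ℓ.IsAct) : ¬ ℓ.IsEmit := by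
  cases ℓ
  · exact id
  all_goals exact h.elim

theorem Lab.IsRecvOrDisc.eq_recv {ℓ : Lab C B S} {b : B} (h : ℓ.IsRecvOrDisc b)
    (hl : ℓ.IsEmit ∨ ℓ.IsAct) : ℓ = .act (.recv b) := by
  rcases h with h | rfl
  · exact h
  · exact (hl.elim id id : False).elim

theorem PossibleSuccessor.leadsTo {χ ζ χ' : Tr E} (hi : χ.RelabelsInjectively)
    (h : PossibleSuccessor χ ζ χ') : LeadsTo χ ζ χ' := by
  induction χ using Tr.name_induction generalizing ζ χ' with
  | act χ α P hχ =>
    by_cases hact : ζ.lab.IsAct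
    swap
    · exact .of_not_isAct hi h hact
    obtain ⟨hs, hs', hc, hl⟩ := possibleSuccessor_iff.1 h
    obtain ⟨s, l, -⟩ := Tr.of_name_act hχ
    rcases Tr.of_src_pre (hs.symm.trans s) with hζ | ⟨b, hζ⟩
    · rw [Tr.synchrons_of_name hχ, Name.synchrons, carry_nil hact] at hc
      -- The only synchron of `χ` is affected by the action, so it is not necessary and the prefix
      -- must be a receive.
      simp only [Synchron.Necessary, reduceCtorEq, exists_false, or_false, not_not,
        Leaf.act.injEq] at hc
      obtain ⟨b, _, rfl, rfl⟩ := hc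
      exact .recv hχ hζ (hs'.trans (Tr.of_name_act hζ).2.2) (hl.isRecvOrDisc (.inl l))
    · rw [(Tr.of_name_disAct hζ).2] at hact
      exact hact.elim
  | disNil χ b hχ =>
    obtain ⟨b', hζ⟩ := Tr.of_src_nil (h.src_eq.symm.trans (Tr.of_name_disNil hχ).1)
    exact .of_not_isAct hi h (by rw [(Tr.of_name_disNil hζ).2]; exact id)
  | disAct χ b α P hχ =>
    by_cases hact : ζ.lab.IsAct
    swap
    · exact .of_not_isAct hi h hact
    obtain ⟨hs, hs', -, hl⟩ := possibleSuccessor_iff.1 h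
    obtain ⟨s, l⟩ := Tr.of_name_disAct hχ
    rcases Tr.of_src_pre (hs.symm.trans s) with hζ | ⟨b, hζ⟩
    · exact .disc hχ hζ (hs'.trans (Tr.of_name_act hζ).2.2) (hl.isRecvOrDisc (.inr l))
    · rw [(Tr.of_name_disAct hζ).2] at hact
      exact hact.elim
  | sig χ P s hχ =>
    by_cases hact : ζ.lab.IsAct
    swap
    · exact .of_not_isAct hi h hact
    obtain ⟨-, -, hc, -⟩ := possibleSuccessor_iff.1 h
    -- An emission leaf is necessary, yet any action of the process affects it.
    rw [Tr.synchrons_of_name hχ, Name.synchrons, carry_nil hact] at hc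
    simp [Synchron.Necessary] at hc
  | sumL χ t Q hχ ih =>
    by_cases hact : ζ.lab.IsAct
    swap
    · exact .of_not_isAct hi h hact
    obtain ⟨hs, hs', hc, hl⟩ := possibleSuccessor_iff.1 h
    obtain ⟨s, l, ha⟩ := Tr.of_name_sumL hχ
    rw [Tr.synchrons_of_name hχ] at hc
    rcases Tr.of_src_sum (hs.symm.trans s) with ⟨v, hv, hζ⟩ | ⟨w, hw, hζ⟩ | ⟨v, w, -, -, hζ⟩
    · obtain ⟨-, l', ha'⟩ := Tr.of_name_sumL hζ
      rw [l'] at hact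
      have hne := hact.not_isEmit
      have g := (ha'.resolve_left hne).2
      exact .sumLL hχ hζ hv.symm (hs'.trans g) hne
        (ih (hi.of_cons (preimage_sumL hχ)) (possibleSuccessor_iff.2 ⟨hv.symm, hs'.trans g,
          ((Under.sumL hζ).carry_dynamic rfl hact).1 hc, by rwa [← l]⟩))
    · obtain ⟨-, l', ha'⟩ := Tr.of_name_sumR hζ
      rw [l'] at hact
      have hne := hact.not_isEmit
      have g := (ha'.resolve_left hne).2
      -- The right summand wins the choice, so `t` has no necessary synchron; being the component of
      -- a `t + Q`, it receives rather than discards.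
      obtain ⟨b, hb⟩ := t.forall_not_necessary_iff.1
        ((carry_sum (by simp) (Under.sumR hζ) hact).1 hc)
      subst hw
      exact .sumLR hχ hζ (hs'.trans g) hne (hb.eq_recv (ha.imp id And.left))
        (hl.isRecvOrDisc (by rwa [l]))
    · obtain ⟨-, b, l', -⟩ := Tr.of_name_sum hζ
      rw [l'] at hact
      exact hact.elim
  | sumR χ u P hχ ih =>
    by_cases hact : ζ.lab.IsAct
    swap
    · exact .of_not_isAct hi h hact
    obtain ⟨hs, hs', hc, hl⟩ := possibleSuccessor_iff.1 h
    obtain ⟨s, l, ha⟩ := Tr.of_name_sumR hχ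
    rw [Tr.synchrons_of_name hχ] at hc
    rcases Tr.of_src_sum (hs.symm.trans s) with ⟨v, hv, hζ⟩ | ⟨w, hw, hζ⟩ | ⟨v, w, -, -, hζ⟩
    · obtain ⟨-, l', ha'⟩ := Tr.of_name_sumL hζ
      rw [l'] at hact
      have hne := hact.not_isEmit
      have g := (ha'.resolve_left hne).2
      obtain ⟨b, hb⟩ := u.forall_not_necessary_iff.1
        ((carry_sum (by simp) (Under.sumL hζ) hact).1 hc)
      subst hv
      exact .sumRL hχ hζ (hs'.trans g) hne (hb.eq_recv (ha.imp id And.left))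
        (hl.isRecvOrDisc (by rwa [l]))
    · obtain ⟨-, l', ha'⟩ := Tr.of_name_sumR hζ
      rw [l'] at hact
      have hne := hact.not_isEmit
      have g := (ha'.resolve_left hne).2
      exact .sumRR hχ hζ hw.symm (hs'.trans g) hne
        (ih (hi.of_cons (preimage_sumR hχ)) (possibleSuccessor_iff.2 ⟨hw.symm, hs'.trans g,
          ((Under.sumR hζ).carry_dynamic rfl hact).1 hc, by rwa [← l]⟩))
    · obtain ⟨-, b, l', -⟩ := Tr.of_name_sum hζ
      rw [l'] at hact
      exact hact.elim
  | sum χ t u hχ iht ihu =>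
    by_cases hact : ζ.lab.IsAct
    swap
    · exact .of_not_isAct hi h hact
    obtain ⟨hs, hs', hc, hl⟩ := possibleSuccessor_iff.1 h
    obtain ⟨s, b, l, lt, lu⟩ := Tr.of_name_sum hχ
    rw [Tr.synchrons_of_name hχ] at hc
    obtain ⟨hct, hcu⟩ := Carry.union_iff.1 hc
    rcases Tr.of_src_sum (hs.symm.trans s) with ⟨v, hv, hζ⟩ | ⟨w, hw, hζ⟩ | ⟨v, w, -, -, hζ⟩
    · obtain ⟨-, l', ha'⟩ := Tr.of_name_sumL hζ
      rw [l'] at hact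
      have hne := hact.not_isEmit
      have g := (ha'.resolve_left hne).2
      exact .sumBL hχ hζ hv.symm (hs'.trans g) hne
        (iht (hi.of_cons (preimage_sum_left hχ)) (possibleSuccessor_iff.2 ⟨hv.symm, hs'.trans g,
          ((Under.sumL hζ).carry_dynamic rfl hact).1 hct, by rwa [lt, ← l]⟩))
    · obtain ⟨-, l', ha'⟩ := Tr.of_name_sumR hζ
      rw [l'] at hact
      have hne := hact.not_isEmit
      have g := (ha'.resolve_left hne).2
      exact .sumBR hχ hζ hw.symm (hs'.trans g) hne
        (ihu (hi.of_cons (preimage_sum_right hχ)) (possibleSuccessor_iff.2 ⟨hw.symm, hs'.trans g,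
          ((Under.sumR hζ).carry_dynamic rfl hact).1 hcu, by rwa [lu, ← l]⟩))
    · obtain ⟨-, b, l', -⟩ := Tr.of_name_sum hζ
      rw [l'] at hact
      exact hact.elim
  | parL χ t Q hχ ih =>
    -- No case distinction on whether `ζ` acts is made for parallel composition: its rules carry no
    -- such condition, and neither do the equivalences for static arguments and for `Beside`.
    obtain ⟨hs, hs', hc, hl⟩ := possibleSuccessor_iff.1 h
    obtain ⟨s, l, -⟩ := Tr.of_name_parL hχ
    have hit := hi.of_cons (preimage_parL hχ)
    rw [Tr.synchrons_of_name hχ] at hc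
    rcases Tr.of_src_par (hs.symm.trans s) with ⟨v, hv, hζ⟩ | ⟨w, hw, hζ⟩ | ⟨v, w, hv, hw, hζ⟩
    · have hc := ((Under.parL hζ).carry_static rfl).1 hc
      obtain ⟨t', ht', hχ'⟩ := Tr.name_parL_of_compat hχ
        (hs'.trans (Tr.of_name_parL hζ).2.2.1) hl hc.labCarry
      rw [preimage_parL hχ'] at hc
      rw [l, (Tr.of_name_parL hχ').2.1] at hl
      exact .parLL hχ hζ hχ' hv.symm ht' (ih hit (possibleSuccessor_iff.2 ⟨hv.symm, ht', hc, hl⟩))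
    · have hc := (Beside.parR hζ).carry.1 hc
      obtain ⟨t', ht', hχ'⟩ := Tr.name_parL_of_compat hχ
        (hs'.trans (Tr.of_name_parR hζ).2.2.1) hl (labCarry_of_subset hc)
      rw [preimage_parL hχ'] at hc
      rw [l, (Tr.of_name_parL hχ').2.1] at hl
      -- The left component did not move, so its transition must recur unchanged.
      obtain rfl := Tr.eq_of_synchrons_subset hit ht'.symm hc hl
      subst hw
      exact .parLR hχ hζ hχ'
    · subst hw
      have hc := ((Under.par_left hζ).carry_static rfl).1 hc
      obtain ⟨t', ht', hχ'⟩ := Tr.name_parL_of_compat hχ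
        (hs'.trans (Tr.of_name_par hζ).2.2) hl hc.labCarry
      rw [preimage_parL hχ'] at hc
      rw [l, (Tr.of_name_parL hχ').2.1] at hl
      exact .parLB hχ hζ hχ' hv.symm ht' (ih hit (possibleSuccessor_iff.2 ⟨hv.symm, ht', hc, hl⟩))
  | parR χ u P hχ ih =>
    obtain ⟨hs, hs', hc, hl⟩ := possibleSuccessor_iff.1 h
    obtain ⟨s, l, -⟩ := Tr.of_name_parR hχ
    have hiu := hi.of_cons (preimage_parR hχ)
    rw [Tr.synchrons_of_name hχ] at hc
    rcases Tr.of_src_par (hs.symm.trans s) with ⟨v, hv, hζ⟩ | ⟨w, hw, hζ⟩ | ⟨v, w, hv, hw, hζ⟩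
    · have hc := (Beside.parL hζ).carry.1 hc
      obtain ⟨u', hu', hχ'⟩ := Tr.name_parR_of_compat hχ
        (hs'.trans (Tr.of_name_parL hζ).2.2.1) hl (labCarry_of_subset hc)
      rw [preimage_parR hχ'] at hc
      rw [l, (Tr.of_name_parR hχ').2.1] at hl
      obtain rfl := Tr.eq_of_synchrons_subset hiu hu'.symm hc hl
      subst hv
      exact .parRL hχ hζ hχ'
    · have hc := ((Under.parR hζ).carry_static rfl).1 hc
      obtain ⟨u', hu', hχ'⟩ := Tr.name_parR_of_compat hχ
        (hs'.trans (Tr.of_name_parR hζ).2.2.1) hl hc.labCarry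
      rw [preimage_parR hχ'] at hc
      rw [l, (Tr.of_name_parR hχ').2.1] at hl
      exact .parRR hχ hζ hχ' hw.symm hu' (ih hiu (possibleSuccessor_iff.2 ⟨hw.symm, hu', hc, hl⟩))
    · subst hv
      have hc := ((Under.par_right hζ).carry_static rfl).1 hc
      obtain ⟨u', hu', hχ'⟩ := Tr.name_parR_of_compat hχ
        (hs'.trans (Tr.of_name_par hζ).2.2) hl hc.labCarry
      rw [preimage_parR hχ'] at hc
      rw [l, (Tr.of_name_parR hχ').2.1] at hl
      exact .parRB hχ hζ hχ' hw.symm hu' (ih hiu (possibleSuccessor_iff.2 ⟨hw.symm, hu', hc, hl⟩))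
  | par χ t u hχ iht ihu =>
    obtain ⟨hs, hs', hc, hl⟩ := possibleSuccessor_iff.1 h
    obtain ⟨s, -, -⟩ := Tr.of_name_par hχ
    have hit := hi.of_cons (preimage_par_left hχ)
    have hiu := hi.of_cons (preimage_par_right hχ)
    rw [Tr.synchrons_of_name hχ] at hc
    obtain ⟨hct, hcu⟩ := Carry.union_iff.1 hc
    rcases Tr.of_src_par (hs.symm.trans s) with ⟨v, hv, hζ⟩ | ⟨w, hw, hζ⟩ | ⟨v, w, hv, hw, hζ⟩
    · have hct := ((Under.parL hζ).carry_static rfl).1 hct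
      have hcu := (Beside.parL hζ).carry.1 hcu
      obtain ⟨t', u', ht', hu', hχ', lt, lu⟩ := Tr.name_par_of_compat hχ
        (hs'.trans (Tr.of_name_parL hζ).2.2.1) hl hct.labCarry (labCarry_of_subset hcu)
      rw [preimage_par_left hχ'] at hct
      rw [preimage_par_right hχ'] at hcu
      obtain rfl := Tr.eq_of_synchrons_subset hiu hu'.symm hcu lu
      exact .parBL hχ hζ hχ' hv.symm ht'
        (iht hit (possibleSuccessor_iff.2 ⟨hv.symm, ht', hct, lt⟩))
    · have hct := (Beside.parR hζ).carry.1 hct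
      have hcu := ((Under.parR hζ).carry_static rfl).1 hcu
      obtain ⟨t', u', ht', hu', hχ', lt, lu⟩ := Tr.name_par_of_compat hχ
        (hs'.trans (Tr.of_name_parR hζ).2.2.1) hl (labCarry_of_subset hct) hcu.labCarry
      rw [preimage_par_left hχ'] at hct
      rw [preimage_par_right hχ'] at hcu
      obtain rfl := Tr.eq_of_synchrons_subset hit ht'.symm hct lt
      exact .parBR hχ hζ hχ' hw.symm hu'
        (ihu hiu (possibleSuccessor_iff.2 ⟨hw.symm, hu', hcu, lu⟩))
    · have hct := ((Under.par_left hζ).carry_static rfl).1 hct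
      have hcu := ((Under.par_right hζ).carry_static rfl).1 hcu
      obtain ⟨t', u', ht', hu', hχ', lt, lu⟩ := Tr.name_par_of_compat hχ
        (hs'.trans (Tr.of_name_par hζ).2.2) hl hct.labCarry hcu.labCarry
      rw [preimage_par_left hχ'] at hct
      rw [preimage_par_right hχ'] at hcu
      exact .parBB hχ hζ hχ' hv.symm ht' hw.symm hu'
        (iht hit (possibleSuccessor_iff.2 ⟨hv.symm, ht', hct, lt⟩))
        (ihu hiu (possibleSuccessor_iff.2 ⟨hw.symm, hu', hcu, lu⟩))
  | res χ t L hχ ih =>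
    by_cases hact : ζ.lab.IsAct
    swap
    · exact .of_not_isAct hi h hact
    obtain ⟨hs, hs', hc, hl⟩ := possibleSuccessor_iff.1 h
    obtain ⟨s, l, -⟩ := Tr.of_name_res hχ
    obtain ⟨v, hv, hζ⟩ := Tr.of_src_res (hs.symm.trans s)
    obtain ⟨-, l', g⟩ := Tr.of_name_res hζ
    obtain ⟨t', ht', hχ'⟩ := Tr.of_src_res (hs'.trans g)
    rw [Tr.synchrons_of_name hχ] at hc
    have hc := ((Under.res hζ).carry_static rfl).1 hc
    rw [preimage_res hχ'] at hc
    rw [l, (Tr.of_name_res hχ').2.1] at hl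
    exact .res hχ hζ hχ' hv.symm ht' (by rwa [← l'])
      (ih (hi.of_cons (preimage_res hχ)) (possibleSuccessor_iff.2 ⟨hv.symm, ht', hc, hl⟩))
  | rel χ t f hχ ih =>
    by_cases hact : ζ.lab.IsAct
    swap
    · exact .of_not_isAct hi h hact
    obtain ⟨hs, hs', hc, hl⟩ := possibleSuccessor_iff.1 h
    obtain ⟨s, l, -⟩ := Tr.of_name_rel hχ
    obtain ⟨v, hv, hζ⟩ := Tr.of_src_rel (hs.symm.trans s)
    obtain ⟨-, l', g⟩ := Tr.of_name_rel hζ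
    obtain ⟨t', ht', hχ'⟩ := Tr.of_src_rel (hs'.trans g)
    rw [Tr.synchrons_of_name hχ] at hc
    have hc := ((Under.rel hζ).carry_static rfl).1 hc
    rw [preimage_rel hχ'] at hc
    rw [l, (Tr.of_name_rel hχ').2.1] at hl
    rw [l', Relabelling.lab_isAct] at hact
    exact .rel hχ hζ hχ' hv.symm ht' hact
      (ih (hi.of_cons (preimage_rel hχ)) (possibleSuccessor_iff.2 ⟨hv.symm, ht', hc,
        -- Here `ζ` may have affected all synchrons of `t`, so injectivity is indispensable for
        -- received or discarded broadcasts.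
        hc.labCarry.compat_of_relabel t.labs_nonempty t.labSpec t'.labSpec
          (hi.injective hχ) hl⟩))
  | agent χ t X hχ ih =>
    by_cases hact : ζ.lab.IsAct
    swap
    · exact .of_not_isAct hi h hact
    obtain ⟨hs, hs', hc, hl⟩ := possibleSuccessor_iff.1 h
    obtain ⟨s, ht, l, -⟩ := Tr.of_name_agent hχ
    obtain ⟨v, hv, hζ⟩ := Tr.of_src_agent (hs.symm.trans s)
    obtain ⟨-, -, l', g⟩ := Tr.of_name_agent hζ
    rw [l'] at hact
    rw [Tr.synchrons_of_name hχ] at hc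
    have hs' := hs'.trans (g hact)
    exact .agent hχ hζ (ht.trans hv.symm) hs' hact
      (ih (hi.of_cons (preimage_agent hχ)) (possibleSuccessor_iff.2 ⟨ht.trans hv.symm, hs',
        ((Under.agent hζ).carry_dynamic rfl hact).1 hc, by rwa [← l]⟩))
  | signal χ t r hχ ih =>
    by_cases hact : ζ.lab.IsAct
    swap
    · exact .of_not_isAct hi h hact
    obtain ⟨hs, hs', hc, hl⟩ := possibleSuccessor_iff.1 h
    obtain ⟨s, l, -⟩ := Tr.of_name_signal hχ
    rcases Tr.of_src_signal (hs.symm.trans s) with hζ | ⟨v, hv, hζ⟩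
    · rw [(Tr.of_name_sig hζ).2] at hact
      exact hact.elim
    · obtain ⟨-, l', g⟩ := Tr.of_name_signal hζ
      rw [l'] at hact
      rw [Tr.synchrons_of_name hχ] at hc
      have hs' := hs'.trans (g hact)
      exact .signal hχ hζ hv.symm hs' hact
        (ih (hi.of_cons (preimage_signal hχ)) (possibleSuccessor_iff.2 ⟨hv.symm, hs',
          ((Under.signal hζ).carry_dynamic rfl hact).1 hc, by rwa [← l]⟩))

end ABCdE

theorem mainTheorem5 {A C B S : Type*} (E : ABCdE.DefEqs A C B S) :
    (∀ χ ζ χ' : ABCdE.Tr E, ABCdE.LeadsTo χ ζ χ' → ABCdE.PossibleSuccessor χ ζ χ') ∧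
    (∀ χ ζ χ' : ABCdE.Tr E, χ.RelabelsInjectively →
      ABCdE.PossibleSuccessor χ ζ χ' → ABCdE.LeadsTo χ ζ χ') :=
  ⟨fun _ _ _ h => h.possibleSuccessor, fun _ _ _ hi h => h.leadsTo hi⟩
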